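/- **Setting.** Let $F$ (facilities, non-empty) and $C$ (cities) be finite sets, with opening costs $f_i\ge 0$ and connection costs $c_{ij}\ge 0$ that form a *squared metric*: $\sqrt{c_{ij}}\le\sqrt{c_{ij'}}+\sqrt{c_{i'j'}}+\sqrt{c_{i'j}}$ for all facilities $i,i'$ and cities $j,j'$ (an instance of the Squared Metric Facility Location Problem). The natural LP relaxation is to minimize $\sum_i y_if_i+\sum_j\sum_i x_{ij}c_{ij}$ subject to $\sum_i x_{ij}=1$ for all $j$, $x_{ij}\le y_i$ and $x_{ij},y_i\ge0$ for all $i,j$. **Algorithm $CS(\gamma)$** ($\gamma\ge1$). (1) Take an optimal LP solution $(x^*,y^*)$. (2) Scale the opening variables by $\gamma$ and reassign every city entirely to its closest facilities; split facilities into copies (a copy has the costs of its original), so that one obtains $(\bar x,\bar y)$ on the copies with: $0\le\bar y_k\le1$; the copies $k$ of $i$ satisfy $\sum_k\bar y_k=\gamma y_i^*$; $0\le\bar x_{kj}\le\bar y_k$ and $\sum_k\bar x_{kj}=1$; if $\bar x_{kj}>0$ and $c_{k'j}<c_{kj}$ then $\bar x_{k'j}=\bar y_{k'}$; and if $\bar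 x_{kj}>0$ then $\bar x_{kj}=\bar y_k$. (3) Let $C_j=\{k:\bar x_{kj}>0\}$, $d^{(c)}_j=\sum_{k\in C_j}c_{kj}\bar y_k/\sum_{k\in C_j}\bar y_k$ and $d^{(\max)}_j=\max_{k\in C_j}c_{kj}$. While cities remain, select a remaining city $j$ with $d^{(c)}_j+d^{(\max)}_j$ minimum as a cluster center, with cluster $C_j$, and remove $j$ and all remaining cities $j'$ with $C_j\cap C_{j'}\neq\emptyset$. (4) Independently, for each cluster center $j$ open exactly one copy of $C_j$, namely $k$ with probability $\bar x_{kj}=\bar y_k$, and open each copy $k$ that is in no cluster with probability $\bar y_k$. A facility is open if one of its copies is. Connect each city to a closest open facility. **Theorem.** Let $\gamma\ge1$. The algorithm $CS(\gamma)$ has an execution on the instance, and for every execution (every choice of the optimal LP solution, of the splitting and of the way to break ties) the following holds. Every outcome gives an integral feasible solution $(x,y)$ of the LP, in which $y_i\in\{0,1\}$ indicates whether $i$ is open and the connection cost of each city $j$ is $\min_{i:y_i=1}c_{ij}$. With $F^*_i=y^*_if_i$ and $C^*_j=\sum_{i\in F}x^*_{ij}c_{ij}$, * for every facility $i$, the expected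 total opening cost of the copies of $i$ (each open copy paying $f_i$) is exactly $\gamma F^*_i$; consequently $E[y_if_i]\le\gamma F^*_i$ when a facility is paid for only once; * for every city $j$, $$E\Big[\min_{i\in F,\,y_i=1}c_{ij}\Big]\le\max\Big\{1+8e^{-\gamma},\ \frac{5e^{-\gamma}+e^{-1}}{1-\frac1\gamma}\Big\}\cdot C^*_j .$$ For $\gamma=1$ the fraction is read as $+\infty$, with the convention $\infty\cdot0=0$. -/

import Mathlib

noncomputable section

namespace FacilityLocation

open Classical MeasureTheory

universe u v w

/-- An instance `(C, F, c, f)` of the facility location problem, with connection costs `c i j` and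
opening costs `f i`, all of them non-negative. -/
structure Instance (F : Type u) (C : Type v) where
  c : F → C → ℝ
  f : F → ℝ
  c_nonneg : ∀ i j, 0 ≤ c i j
  f_nonneg : ∀ i, 0 ≤ f i

/-- The connection cost function is a squared metric. -/
def Instance.IsSquaredMetric {F : Type u} {C : Type v} (I : Instance F C) : Prop :=
  ∀ (i i' : F) (j j' : C),
    √(I.c i j) ≤ √(I.c i j') + √(I.c i' j') + √(I.c i' j)

section LP

variable {F : Type u} {C : Type v} [Fintype F] [Fintype C]

/-- Feasibility for the natural linear programming relaxation. -/
structure Instance.LPFeasible (_I : Instance F C) (x : F → C → ℝ) (y : F → ℝ) : Prop where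
  sum_eq_one : ∀ j, ∑ i, x i j = 1
  le : ∀ i j, x i j ≤ y i
  x_nonneg : ∀ i j, 0 ≤ x i j
  y_nonneg : ∀ i, 0 ≤ y i

/-- The objective function of the linear program. -/
def Instance.lpCost (I : Instance F C) (x : F → C → ℝ) (y : F → ℝ) : ℝ :=
  ∑ i, y i * I.f i + ∑ j, ∑ i, x i j * I.c i j

/-- `(x, y)` is an optimal solution of the linear program. -/
def Instance.LPOptimal (I : Instance F C) (x : F → C → ℝ) (y : F → ℝ) : Prop :=
  I.LPFeasible x y ∧ ∀ x' y', I.LPFeasible x' y' → I.lpCost x y ≤ I.lpCost x' y'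

end LP

/-- Greedy clustering. Each city `j` comes with its set `close j` of close facilities and with
a number `score j`. `GreedyCenters close score U T` says that `T` is the set of cluster centers
that may be selected (with some way to break ties) when `U` is the set of remaining cities: as long
as cities remain, a remaining city of minimum score becomes a center, and it is removed together
with all the cities that share a close facility with it. -/
inductive GreedyCenters {C : Type v} {K : Type w} (close : C → Finset K) (score : C → ℝ) :
    Finset C → Finset C → Prop
  | done : GreedyCenters close score ∅ ∅
  | step (U T : Finset C) (j : C) (hj : j ∈ U) (hmin : ∀ j' ∈ U, score j ≤ score j')
      (hT : GreedyCenters close score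
        ((U.erase j).filter fun j' => Disjoint (close j) (close j')) T) :
      GreedyCenters close score U (insert j T)

section Run

variable {F : Type u} {C : Type v} [Fintype F] [Fintype C]

/-- The close facilities of city `j`: those which serve `j` in the fractional solution `xbar`. -/
def closeSet {K : Type w} [Fintype K] (xbar : K → C → ℝ) (j : C) : Finset K :=
  Finset.univ.filter fun k => 0 < xbar k j

/-- The average distance `d(j, A)`, for distances `dist k j` and weights `ybar k`. -/
def avgDist {K : Type w} (dist : K → C → ℝ) (ybar : K → ℝ) (j : C) (A : Finset K) : ℝ :=
  (∑ k ∈ A, dist k j * ybar k) / ∑ k ∈ A, ybar k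

/-- The maximum distance from `j` to a facility in `A`. -/
def maxDist {K : Type w} (dist : K → C → ℝ) (j : C) (A : Finset K) : ℝ :=
  sSup ((fun k => dist k j) '' (A : Set K))

/-- The deterministic part of an execution of `CS(γ)` on the instance `I`, for some choice of the
optimal solution of the linear program, of the way in which facilities are split, and of the way in
which ties are broken. The facilities are split into copies indexed by `K`; `orig k` is the
facility of which `k` is a copy, and copies inherit the costs of their originals. -/
structure CSRun (I : Instance F C) (γ : ℝ) (K : Type w) [Fintype K] where
  /-- The optimal fractional solution. -/
  xs : F → C → ℝ
  ys : F → ℝ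
  optimal : I.LPOptimal xs ys
  /-- The splitting and the scaled opening variables: the copies of `i` share `γ * ys i`. -/
  orig : K → F
  ybar : K → ℝ
  ybar_nonneg : ∀ k, 0 ≤ ybar k
  ybar_le_one : ∀ k, ybar k ≤ 1
  ybar_sum : ∀ i, ∑ k ∈ Finset.univ.filter (fun k => orig k = i), ybar k = γ * ys i
  /-- The new assignment: every city is served entirely by its closest facilities. -/
  xbar : K → C → ℝ
  xbar_nonneg : ∀ k j, 0 ≤ xbar k j
  xbar_le : ∀ k j, xbar k j ≤ ybar k
  xbar_sum : ∀ j, ∑ k, xbar k j = 1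
  closest : ∀ k k' j, 0 < xbar k j → I.c (orig k') j < I.c (orig k) j → xbar k' j = ybar k'
  /-- The solution is complete. -/
  complete : ∀ k j, 0 < xbar k j → xbar k j = ybar k
  /-- The cluster centers, selected greedily by the sum of the average distance and the maximum
  distance from the close facilities. -/
  centers : Finset C
  greedy : GreedyCenters (closeSet xbar)
    (fun j => avgDist (fun k j => I.c (orig k) j) ybar j (closeSet xbar j)
      + maxDist (fun k j => I.c (orig k) j) j (closeSet xbar j)) Finset.univ centers

namespace CSRun

variable {I : Instance F C} {γ : ℝ} {K : Type w} [Fintype K] (R : CSRun I γ K)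

/-- The facilities (copies) that lie in no cluster. -/
def unclustered : Finset K :=
  Finset.univ.filter fun k => ∀ j ∈ R.centers, k ∉ closeSet R.xbar j

/-- The outcomes of the random choices of the rounding procedure: a close facility for every cluster
center, and for every unclustered facility whether it is opened. -/
abbrev Outcome : Type (max v w) :=
  ((j : {j // j ∈ R.centers}) → {k // k ∈ closeSet R.xbar j.1}) ×
    ({k // k ∈ R.unclustered} → Bool)

instance : MeasurableSpace R.Outcome := ⊤

/-- The probability of an outcome. All choices are independent; the center `j` selects `k` with
probability `xbar k j`, and the unclustered facility `k` is opened with probability `ybar k`. -/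
def prob (ω : R.Outcome) : ℝ :=
  (∏ j, R.xbar (ω.1 j).1 j.1) * ∏ k, (if ω.2 k then R.ybar k.1 else 1 - R.ybar k.1)

theorem prob_nonneg (ω : R.Outcome) : 0 ≤ R.prob ω := by
  refine mul_nonneg (Finset.prod_nonneg fun j _ => R.xbar_nonneg _ _)
    (Finset.prod_nonneg fun k _ => ?_)
  split_ifs
  · exact R.ybar_nonneg _
  · exact sub_nonneg.2 (R.ybar_le_one _)

theorem sum_prob : ∑ ω, R.prob ω = 1 := by
  have h1 : ∀ j : {j // j ∈ R.centers},
      ∑ k : {k // k ∈ closeSet R.xbar j.1}, R.xbar k.1 j.1 = 1 := by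
    intro j
    rw [← R.xbar_sum j.1, Finset.sum_coe_sort (closeSet R.xbar j.1) (fun k => R.xbar k j.1)]
    refine Finset.sum_subset (Finset.subset_univ _) fun k _ hk => ?_
    have : ¬ 0 < R.xbar k j.1 := by simpa [closeSet] using hk
    exact le_antisymm (not_lt.1 this) (R.xbar_nonneg _ _)
  have h2 : ∀ k : {k // k ∈ R.unclustered},
      ∑ b : Bool, (if b then R.ybar k.1 else 1 - R.ybar k.1) = 1 := by
    intro k
    simp
  have h3 : ∑ p : (j : {j // j ∈ R.centers}) → {k // k ∈ closeSet R.xbar j.1},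
      ∏ j, R.xbar (p j).1 j.1 = 1 := by
    rw [← Fintype.prod_sum (fun (j : {j // j ∈ R.centers})
      (k : {k // k ∈ closeSet R.xbar j.1}) => R.xbar k.1 j.1)]
    simp only [h1, Finset.prod_const_one]
  have h4 : ∑ b : {k // k ∈ R.unclustered} → Bool,
      ∏ k, (if b k then R.ybar k.1 else 1 - R.ybar k.1) = 1 := by
    rw [← Fintype.prod_sum (fun (k : {k // k ∈ R.unclustered}) (b : Bool) =>
      if b then R.ybar k.1 else 1 - R.ybar k.1)]
    simp only [h2, Finset.prod_const_one]
  have h5 := congrArg₂ (· * ·) h3 h4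
  simp only [Finset.sum_mul_sum, mul_one] at h5
  rw [Fintype.sum_prod_type]
  simp only [prob]
  convert h5 using 5

/-- The law of the random choices of the rounding procedure. -/
def law : PMF R.Outcome :=
  PMF.ofFintype (fun ω => ENNReal.ofReal (R.prob ω)) (by
    rw [← ENNReal.ofReal_sum_of_nonneg fun ω _ => R.prob_nonneg ω, R.sum_prob, ENNReal.ofReal_one])

/-- The expected value of a random variable over the random choices of the rounding procedure. -/
def expectation (X : R.Outcome → ℝ) : ℝ := ∫ ω, X ω ∂(R.law.toMeasure)

/-- The set of opened copies. -/
def openCopies (ω : R.Outcome) : Finset K :=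
  Finset.univ.filter fun k =>
    (∃ j, (ω.1 j).1 = k) ∨ ∃ h : k ∈ R.unclustered, ω.2 ⟨k, h⟩ = true

/-- The facilities of `I` that are opened, i.e. those with an opened copy. -/
def openFacilities (ω : R.Outcome) : Finset F := (R.openCopies ω).image R.orig

/-- The cost of connecting city `j` to its closest opened facility. -/
def connectionCost (ω : R.Outcome) (j : C) : ℝ :=
  sInf ((fun i => I.c i j) '' (R.openFacilities ω : Set F))

/-- The total opening cost of the copies of `i`, each opened copy being paid for. -/
def facilityCost (ω : R.Outcome) (i : F) : ℝ :=
  ∑ k ∈ R.openCopies ω, if R.orig k = i then I.f i else 0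

/-- The integral opening variable `y i` in the original instance. -/
def openVar (ω : R.Outcome) (i : F) : ℝ := if i ∈ R.openFacilities ω then 1 else 0

end CSRun

end Run

end FacilityLocation

end

/-!
An execution exists because the linear program has an optimal solution by compactness
(`Instance.exists_lpOptimal`) and because the facilities can be split for all cities at once by a
product measure (`exists_csRun`).

In an execution a copy is open with probability `ybar` (`CSRun.probClosed_singleton`), which gives
the opening costs. For the connection cost of a city `j`, let `A` be its close facilities, with
average distance `dc` and maximum distance `dm`. The scaled solution `γ * xs` can be rearranged,
at no extra cost, to use `A` fully (`CSRun.exists_weights`); the rest of it is the distant part,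
of total weight `γ - 1` and average distance `dd ≥ dm`, so that `dc + (γ - 1) * dd` is at most `γ`
times the fractional connection cost of `j`. The target is the bound `(1 - e⁻¹ + 3 * exp (-γ)) *
dc + (e⁻¹ + 5 * exp (-γ)) * dd`, in which the terms `3 * dc + 6 * dd` stand for the fallback to a
facility in the cluster `B` of a center `j'` with `A ∩ B ≠ ∅` whose average and maximum distances
add up to at most `dc + dm`.

The bias of the choice in `B`, given that the close and distant facilities are closed, is the main
difficulty: the facilities of `B` that do not serve `j` may be farther from `j'` than the average.
The probability that no copy within distance `τ` of `j` is open is at most the exact probability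
for the cluster `B` times an exponential for everything else (`CSRun.probClosed_le`). By the layer
cake principle (`sum_mul_le_of_layers`) the expected cost is at most any linear combination of
distances whose superlevel sums dominate these probabilities
(`CSRun.expectation_connectionCost_le`). Two such combinations are used. The first one merges all
the distant facilities (`merged_coefficients`), and suffices unless the distant facilities in `B`
are farther away than `dd`. The second one places the distant facilities outside `B` before the
whole of `B` (`split_coefficients`); the distance of the distant facilities in `B` then makes up
for the bias, because `3 + e ≤ (exp m + 5) / m` for all `m > 0`. The choice between them is made
in `cost_le_of_coefficients`, and the result for the execution is `CSRun.exists_distant_bound`.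

For `γ = 1` the fraction is infinite, so that only cities with fractional connection cost zero
matter; they are connected at cost zero in every outcome (`CSRun.connectionCost_eq_zero`).
-/

noncomputable section

namespace FacilityLocation

open Classical MeasureTheory

universe u v w

/-! ### Existence of an execution -/

/-- The greedy clustering never gets stuck. -/
theorem exists_greedyCenters {C : Type v} {K : Type w} (close : C → Finset K) (score : C → ℝ)
    (U : Finset C) : ∃ T, GreedyCenters close score U T := by
  induction U using Finset.strongInduction with
  | H U ih =>
    rcases U.eq_empty_or_nonempty with rfl | hU
    · exact ⟨∅, .done⟩
    · obtain ⟨j, hj, hmin⟩ := U.exists_min_image score hU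
      obtain ⟨T, hT⟩ := ih ((U.erase j).filter fun j' => Disjoint (close j) (close j'))
        ((Finset.filter_subset _ _).trans_ssubset (Finset.erase_ssubset hj))
      exact ⟨insert j T, .step U T j hj hmin hT⟩

/-- The linear program has an optimal solution: capping the opening variables at `1` preserves
feasibility and does not increase the cost, so it suffices to minimize over a compact set. -/
theorem Instance.exists_lpOptimal {F : Type u} {C : Type v} [Fintype F] [Fintype C] [Nonempty F]
    (I : Instance F C) : ∃ x y, I.LPOptimal x y := by
  set S : Set ((F → C → ℝ) × (F → ℝ)) :=
    {p | I.LPFeasible p.1 p.2} ∩ {p | ∀ i, p.2 i ≤ 1} with hS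
  have hx1 : ∀ x y, I.LPFeasible x y → ∀ i j, x i j ≤ 1 := by
    intro x y h i j
    rw [← h.sum_eq_one j]
    exact Finset.single_le_sum (f := fun i => x i j) (fun i _ => h.x_nonneg i j)
      (Finset.mem_univ i)
  have hsub : S ⊆ (Set.Icc 0 1 : Set ((F → C → ℝ) × (F → ℝ))) := by
    rintro ⟨x, y⟩ ⟨h, hy⟩
    exact ⟨⟨fun i j => h.x_nonneg i j, fun i => h.y_nonneg i⟩,
      ⟨fun i j => hx1 x y h i j, fun i => hy i⟩⟩
  have hclosed : IsClosed S := by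
    have : S = (⋂ j, {p | ∑ i, p.1 i j = 1}) ∩ (⋂ i, ⋂ j, {p | p.1 i j ≤ p.2 i}) ∩
        (⋂ i, ⋂ j, {p | 0 ≤ p.1 i j}) ∩ (⋂ i, {p | 0 ≤ p.2 i}) ∩ (⋂ i, {p | p.2 i ≤ 1}) := by
      ext p
      simp only [hS, Set.mem_inter_iff, Set.mem_iInter, Set.mem_ofPred_eq]
      exact ⟨fun h => ⟨⟨⟨⟨h.1.1, h.1.2⟩, h.1.3⟩, h.1.4⟩, h.2⟩,
        fun h => ⟨⟨h.1.1.1.1, h.1.1.1.2, h.1.1.2, h.1.2⟩, h.2⟩⟩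
    rw [this]
    refine IsClosed.inter (IsClosed.inter (IsClosed.inter (IsClosed.inter ?_ ?_) ?_) ?_) ?_
    · exact isClosed_iInter fun j => isClosed_eq (by fun_prop) (by fun_prop)
    · exact isClosed_iInter fun i => isClosed_iInter fun j =>
        isClosed_le (by fun_prop) (by fun_prop)
    · exact isClosed_iInter fun i => isClosed_iInter fun j =>
        isClosed_le (by fun_prop) (by fun_prop)
    · exact isClosed_iInter fun i => isClosed_le (by fun_prop) (by fun_prop)
    · exact isClosed_iInter fun i => isClosed_le (by fun_prop) (by fun_prop)
  have hcomp : IsCompact S := by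
    refine IsCompact.of_isClosed_subset (s := Set.Icc 0 1) ?_ hclosed hsub
    rw [Set.Icc_prod_eq]
    exact isCompact_Icc.prod isCompact_Icc
  have hne : S.Nonempty := by
    obtain ⟨i₀⟩ := ‹Nonempty F›
    refine ⟨(fun i _ => if i = i₀ then 1 else 0, fun _ => 1), ⟨?_, ?_, ?_, ?_⟩, ?_⟩
    · intro j; simp
    · intro i j; dsimp only; split_ifs <;> norm_num
    · intro i j; dsimp only; split_ifs <;> norm_num
    · intro i; simp
    · intro i; simp
  have hcont : ContinuousOn (fun p : (F → C → ℝ) × (F → ℝ) => I.lpCost p.1 p.2) S := by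
    unfold Instance.lpCost
    fun_prop
  obtain ⟨p, hp, hmin⟩ := hcomp.exists_isMinOn hne hcont
  refine ⟨p.1, p.2, hp.1, fun x y h => ?_⟩
  have hmem : (x, fun i => min (y i) 1) ∈ S :=
    ⟨⟨h.sum_eq_one, fun i j => le_min (h.le i j) (hx1 x y h i j), h.x_nonneg,
      fun i => le_min (h.y_nonneg i) zero_le_one⟩, fun i => min_le_right _ _⟩
  refine (hmin hmem).trans ?_
  simp only [Instance.lpCost]
  gcongr with i
  · exact I.f_nonneg i
  · exact min_le_left _ _

/-- A city can be served entirely by its closest facilities, within capacities `Y`: a cheapest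
assignment has this property, since otherwise some of the demand could be shifted to a closer
facility. -/
theorem exists_closest_assignment {F : Type u} [Fintype F] (c Y t₀ : F → ℝ)
    (h0 : ∀ i, 0 ≤ t₀ i) (hY : ∀ i, t₀ i ≤ Y i) (hsum : ∑ i, t₀ i = 1) :
    ∃ t : F → ℝ, (∀ i, 0 ≤ t i) ∧ (∀ i, t i ≤ Y i) ∧ ∑ i, t i = 1 ∧
      ∀ i i', 0 < t i → c i' < c i → t i' = Y i' := by
  set S : Set (F → ℝ) := Set.Icc 0 Y ∩ {t | ∑ i, t i = 1} with hS
  have hcomp : IsCompact S :=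
    isCompact_Icc.inter_right (isClosed_eq (by fun_prop) (by fun_prop))
  have hcont : ContinuousOn (fun t : F → ℝ => ∑ i, t i * c i) S := by fun_prop
  obtain ⟨t, ⟨⟨ht0, htY⟩, hts⟩, hmin⟩ := hcomp.exists_isMinOn ⟨t₀, ⟨h0, hY⟩, hsum⟩ hcont
  refine ⟨t, ht0, htY, hts, fun i i' hi hc => ?_⟩
  by_contra hne
  have hlt : t i' < Y i' := lt_of_le_of_ne (htY i') hne
  have hii : i' ≠ i := by rintro rfl; exact lt_irrefl _ hc
  set ε := min (t i) (Y i' - t i') with hε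
  have hεpos : 0 < ε := lt_min hi (sub_pos.2 hlt)
  have hsingle : ∀ w : F → ℝ,
      ∑ k, (t k + (if k = i' then ε else 0) - (if k = i then ε else 0)) * w k =
        ∑ k, t k * w k + ε * w i' - ε * w i := by
    intro w
    simp [sub_mul, add_mul, Finset.sum_add_distrib, Finset.sum_sub_distrib, ite_mul]
  have hmem : (fun k => t k + (if k = i' then ε else 0) - (if k = i then ε else 0)) ∈ S := by
    refine ⟨⟨fun k => ?_, fun k => ?_⟩, ?_⟩
    · have h1 : ε ≤ t i := min_le_left _ _
      have h2 := ht0 k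
      simp only [Pi.zero_apply] at h2 ⊢
      by_cases hk : k = i
      · subst hk
        simp [hii.symm, h1]
      · simp only [hk, if_false]
        split_ifs <;> linarith
    · have h1 : ε ≤ Y i' - t i' := min_le_right _ _
      have h2 := htY k
      by_cases hk : k = i'
      · subst hk
        simp only [hii, if_true, if_false]
        linarith
      · simp only [hk, if_false]
        split_ifs <;> linarith
    · have := hsingle fun _ => 1
      simp only [mul_one] at this
      simp only [Set.mem_ofPred_eq] at hts ⊢
      rw [this, hts]
      ring
  have h1 : ∑ k, t k * c k ≤
      ∑ k, (t k + (if k = i' then ε else 0) - (if k = i then ε else 0)) * c k :=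
    hmin hmem
  rw [hsingle c] at h1
  nlinarith

/-- The probability that independent coins with success probabilities `p j` all come out as
`φ`. -/
def coinProb {C : Type v} [Fintype C] (p : C → ℝ) (φ : C → Bool) : ℝ :=
  ∏ j, if φ j then p j else 1 - p j

theorem coinProb_nonneg {C : Type v} [Fintype C] {p : C → ℝ} (h0 : ∀ j, 0 ≤ p j)
    (h1 : ∀ j, p j ≤ 1) (φ : C → Bool) : 0 ≤ coinProb p φ :=
  Finset.prod_nonneg fun j _ => by
    split_ifs
    · exact h0 j
    · exact sub_nonneg.2 (h1 j)

theorem sum_coinProb {C : Type v} [Fintype C] (p : C → ℝ) : ∑ φ, coinProb p φ = 1 := by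
  unfold coinProb
  rw [← Fintype.prod_sum (fun j (b : Bool) => if b then p j else 1 - p j)]
  simp

theorem sum_coinProb_ite {C : Type v} [Fintype C] (p : C → ℝ) (j : C) :
    ∑ φ : C → Bool, (if φ j then coinProb p φ else 0) = p j := by
  have : ∀ φ : C → Bool, (if φ j then coinProb p φ else 0)
      = ∏ l, (if φ l then p l else if l = j then 0 else 1 - p l) := by
    intro φ
    split_ifs with h
    · refine Finset.prod_congr rfl fun l _ => ?_
      by_cases hl : l = j
      · subst hl; simp [h]
      · simp [hl]
    · exact (Finset.prod_eq_zero (Finset.mem_univ j) (by simp [h])).symm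
  simp only [this]
  rw [← Fintype.prod_sum (fun l (b : Bool) => if b then p l else if l = j then 0 else 1 - p l)]
  rw [Finset.prod_eq_single j]
  · simp
  · intro l _ hl; simp [hl]
  · simp

/-- A facility is split as if every city tossed an independent coin for every piece: the copies of
`i` are indexed by the sets of cities they serve (and by a further index that makes them small), and
the copy for a set `φ` gets the share of `i` that a product measure gives to `φ`. This makes all the
cities completely served at once. -/
theorem exists_csRun {F : Type u} {C : Type v} [Fintype F] [Fintype C] [Nonempty F]
    (I : Instance F C) {γ : ℝ} (hγ : 1 ≤ γ) : ∃ n : ℕ, Nonempty (CSRun I γ (Fin n)) := by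
  obtain ⟨xs, ys, hopt⟩ := I.exists_lpOptimal
  have hfeas := hopt.1
  set Y : F → ℝ := fun i => γ * ys i with hYdef
  have hY0 : ∀ i, 0 ≤ Y i := fun i => mul_nonneg (by linarith) (hfeas.y_nonneg i)
  have ht := fun j => exists_closest_assignment (fun i => I.c i j) Y (fun i => xs i j)
    (fun i => hfeas.x_nonneg i j)
    (fun i => (hfeas.le i j).trans (le_mul_of_one_le_left (hfeas.y_nonneg i) hγ))
    (hfeas.sum_eq_one j)
  choose t ht0 htY htsum htclose using ht
  obtain ⟨N, hN⟩ : ∃ N : ℕ, ∀ i, Y i ≤ N := by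
    obtain ⟨N, hN⟩ := exists_nat_ge (∑ i, Y i)
    exact ⟨N, fun i => (Finset.single_le_sum (fun i _ => hY0 i) (Finset.mem_univ i)).trans hN⟩
  have hNpos : (0 : ℝ) < (N + 1 : ℕ) := by positivity
  set p : F → C → ℝ := fun i j => t j i / Y i with hp
  have hp0 : ∀ i j, 0 ≤ p i j := fun i j => div_nonneg (ht0 j i) (hY0 i)
  have hp1 : ∀ i j, p i j ≤ 1 := fun i j => div_le_one_of_le₀ (htY j i) (hY0 i)
  set L := F × (C → Bool) × Fin (N + 1) with hL
  set yb : L → ℝ := fun k => Y k.1 / (N + 1 : ℕ) * coinProb (p k.1) k.2.1 with hyb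
  have hyb0 : ∀ k, 0 ≤ yb k := fun k =>
    mul_nonneg (div_nonneg (hY0 _) hNpos.le) (coinProb_nonneg (hp0 _) (hp1 _) _)
  have hyb1 : ∀ k, yb k ≤ 1 := fun k => by
    refine mul_le_one₀ ((div_le_one hNpos).2 ((hN _).trans (by simp)))
      (coinProb_nonneg (hp0 _) (hp1 _) _) ?_
    rw [← sum_coinProb (p k.1)]
    exact Finset.single_le_sum (f := coinProb (p k.1))
      (fun φ _ => coinProb_nonneg (hp0 _) (hp1 _) φ) (Finset.mem_univ _)
  have hsumN : ∀ (i : F) (w : (C → Bool) → ℝ),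
      ∑ q : (C → Bool) × Fin (N + 1), Y i / (N + 1 : ℕ) * w q.1 = Y i * ∑ φ, w φ := by
    intro i w
    rw [Fintype.sum_prod_type]
    simp only [Finset.sum_const, Finset.card_univ, Fintype.card_fin, nsmul_eq_mul]
    rw [Finset.mul_sum]
    refine Finset.sum_congr rfl fun φ _ => ?_
    field_simp
  set e := (Fintype.equivFin L).symm with he
  set xb : Fin (Fintype.card L) → C → ℝ := fun k j => if (e k).2.1 j then yb (e k) else 0 with hxb
  obtain ⟨T, hT⟩ := exists_greedyCenters (closeSet xb)
    (fun j => avgDist (fun k j => I.c (e k).1 j) (fun k => yb (e k)) j (closeSet xb j)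
      + maxDist (fun k j => I.c (e k).1 j) j (closeSet xb j)) Finset.univ
  refine ⟨Fintype.card L, ⟨{
    xs := xs, ys := ys, optimal := hopt, orig := fun k => (e k).1, ybar := fun k => yb (e k)
    ybar_nonneg := fun k => hyb0 _, ybar_le_one := fun k => hyb1 _
    ybar_sum := ?_, xbar := xb, xbar_nonneg := ?_, xbar_le := ?_, xbar_sum := ?_
    closest := ?_, complete := ?_, centers := T, greedy := hT }⟩⟩
  · intro i
    rw [Finset.sum_filter, e.sum_comp (fun k : L => if k.1 = i then yb k else 0),
      Fintype.sum_prod_type, Finset.sum_eq_single i]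
    · simp only [if_true, hyb]
      rw [hsumN i (coinProb (p i)), sum_coinProb, mul_one]
    · intro b _ hb; simp [hb]
    · simp
  · intro k j; dsimp only [xb]; split_ifs; exacts [hyb0 _, le_rfl]
  · intro k j; dsimp only [xb]; split_ifs; exacts [le_rfl, hyb0 _]
  · intro j
    rw [e.sum_comp (fun k : L => if k.2.1 j then yb k else 0), Fintype.sum_prod_type, ← htsum j]
    refine Finset.sum_congr rfl fun i _ => ?_
    have : ∀ q : (C → Bool) × Fin (N + 1), (if q.1 j then yb (i, q) else 0)
        = Y i / (N + 1 : ℕ) * (if q.1 j then coinProb (p i) q.1 else 0) := by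
      intro q; simp only [hyb]; split_ifs <;> simp
    simp only [this]
    rw [hsumN i (fun φ => if φ j then coinProb (p i) φ else 0), sum_coinProb_ite]
    by_cases h : Y i = 0
    · have := htY j i
      rw [h] at this
      rw [h, zero_mul, le_antisymm this (ht0 j i)]
    · simp only [hp]; field_simp
  · intro k k' j hk hc
    dsimp only [xb] at hk ⊢
    have hφ : (e k).2.1 j = true := by
      by_contra h; simp [h] at hk
    rw [hφ] at hk
    simp only [if_true] at hk
    have hti : 0 < t j (e k).1 := by
      refine lt_of_le_of_ne (ht0 _ _) fun h => hk.ne' ?_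
      simp only [hyb]
      rw [coinProb, Finset.prod_eq_zero (Finset.mem_univ j), mul_zero]
      simp [hφ, hp, ← h]
    have hfull := htclose j (e k).1 (e k').1 hti hc
    split_ifs with h
    · rfl
    · by_cases hz : Y (e k').1 = 0
      · simp [hyb, hz]
      · simp only [hyb]
        rw [coinProb, Finset.prod_eq_zero (Finset.mem_univ j), mul_zero]
        simp [h, hp, hfull, hz]
  · intro k j hk
    dsimp only [xb] at hk ⊢
    split_ifs with h
    · rfl
    · simp [h] at hk

/-! ### Layer cake -/

/-- Layer cake principle for finite linear combinations: it suffices to check a homogeneous linear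
inequality on the indicators of the superlevel sets. -/
theorem sum_mul_nonneg_of_layers {ι : Type*} [Fintype ι] (l a : ι → ℝ) (ha : ∀ i, 0 ≤ a i)
    (h : ∀ τ, 0 ≤ τ → 0 ≤ ∑ i, l i * (if τ < a i then 1 else 0)) : 0 ≤ ∑ i, l i * a i := by
  obtain ⟨B, hB⟩ : ∃ B : ℝ, ∀ i, a i ≤ B :=
    ⟨∑ i, a i, fun i => Finset.single_le_sum (fun i _ => ha i) (Finset.mem_univ i)⟩
  rcases isEmpty_or_nonempty ι with _ | ⟨⟨i₀⟩⟩
  · simp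
  have hB0 : 0 ≤ B := (ha i₀).trans (hB i₀)
  have hfun : ∀ i, (fun τ : ℝ => l i * (if τ < a i then 1 else 0))
      = fun τ => (Set.Iio (a i)).indicator (fun _ => l i) τ := by
    intro i
    ext τ
    simp [Set.indicator_apply]
  have hint : ∀ i, IntervalIntegrable (fun τ : ℝ => l i * (if τ < a i then 1 else 0))
      volume 0 B := by
    intro i
    rw [hfun, intervalIntegrable_iff]
    exact (integrableOn_const (by simp)).indicator measurableSet_Iio
  have hval : ∀ i, ∫ τ in (0 : ℝ)..B, l i * (if τ < a i then 1 else 0) = l i * a i := by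
    intro i
    rw [hfun, intervalIntegral.integral_of_le hB0, integral_indicator measurableSet_Iio,
      Measure.restrict_restrict measurableSet_Iio, setIntegral_const]
    have : volume.real (Set.Iio (a i) ∩ Set.Ioc 0 B) = a i := by
      have h1 : (Set.Iio (a i) ∩ Set.Ioc 0 B : Set ℝ) =ᵐ[volume] Set.Ioc 0 (a i) := by
        have h2 : (Set.Iio (a i) ∩ Set.Ioc 0 B : Set ℝ) = Set.Ioo 0 (a i) := by
          ext τ
          simp only [Set.mem_inter_iff, Set.mem_Iio, Set.mem_Ioc, Set.mem_Ioo]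
          exact ⟨fun h => ⟨h.2.1, h.1⟩, fun h => ⟨h.2, h.1, h.2.le.trans (hB i)⟩⟩
        rw [h2]
        exact Ioo_ae_eq_Ioc
      rw [measureReal_congr h1, Real.volume_real_Ioc_of_le (ha i), sub_zero]
    rw [this, smul_eq_mul, mul_comm]
  rw [← Finset.sum_congr rfl fun i _ => hval i,
    ← intervalIntegral.integral_finsetSum fun i _ => hint i]
  exact intervalIntegral.integral_nonneg hB0 fun τ hτ => h τ hτ.1

/-- The layer cake principle as a comparison of two linear combinations. -/
theorem sum_mul_le_of_layers {ι κ : Type*} [Fintype ι] [Fintype κ] (l a : ι → ℝ) (l' a' : κ → ℝ)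
    (u d : ℝ) (ha : ∀ i, 0 ≤ a i) (ha' : ∀ k, 0 ≤ a' k) (hd : 0 ≤ d)
    (h : ∀ τ, 0 ≤ τ → ∑ i, l i * (if τ < a i then 1 else 0) ≤
      ∑ k, l' k * (if τ < a' k then 1 else 0) + u * (if τ < d then 1 else 0)) :
    ∑ i, l i * a i ≤ ∑ k, l' k * a' k + u * d := by
  have hlayer := sum_mul_nonneg_of_layers
    (Sum.elim (fun i => -l i) (Sum.elim l' fun _ : Unit => u))
    (Sum.elim a (Sum.elim a' fun _ : Unit => d))
    (by rintro (i | k | _); exacts [ha i, ha' k, hd]) (fun τ hτ => by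
      rw [Fintype.sum_sum_type, Fintype.sum_sum_type, Fintype.sum_unique (ι := Unit)]
      change 0 ≤ ∑ i, -l i * (if τ < a i then 1 else 0) +
        (∑ k, l' k * (if τ < a' k then 1 else 0) + u * (if τ < d then 1 else 0))
      have := h τ hτ
      simp only [neg_mul, Finset.sum_neg_distrib]
      linarith)
  simp only [Fintype.sum_sum_type, Sum.elim_inl, Sum.elim_inr, Finset.univ_unique,
    Finset.sum_singleton, neg_mul, Finset.sum_neg_distrib] at hlayer
  linarith

/-! ### Exponential inequalities -/

/-- A chord of `exp (-·)` lies above the graph. -/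
theorem exp_neg_chord {M W : ℝ} (h0 : 0 ≤ W) (hW : W ≤ M) :
    M * Real.exp (-W) ≤ (M - W) + W * Real.exp (-M) := by
  rcases (h0.trans hW).eq_or_lt with rfl | hM
  · have : W = 0 := le_antisymm hW h0
    simp [this]
  have := convexOn_exp.2 (Set.mem_univ 0) (Set.mem_univ (-M))
    (div_nonneg (sub_nonneg.2 hW) hM.le) (div_nonneg h0 hM.le)
    (by field_simp; ring : (M - W) / M + W / M = 1)
  simp only [smul_eq_mul, mul_zero, zero_add, Real.exp_zero, mul_one] at this
  have h2 : W / M * -M = -W := by field_simp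
  rw [h2] at this
  calc M * Real.exp (-W) ≤ M * ((M - W) / M + W / M * Real.exp (-M)) := by gcongr
    _ = _ := by field_simp

theorem exp_mul_one_sub_le_one (v : ℝ) : Real.exp v * (1 - v) ≤ 1 := by
  have h := Real.add_one_le_exp (-v)
  have h2 : Real.exp v * Real.exp (-v) = 1 := by rw [← Real.exp_add]; simp
  nlinarith [Real.exp_pos v]

/-- `3 + e ≤ (e ^ m + 5) / m`; tangent line of the exponential at `m = 7 / 4`. -/
theorem three_add_exp_one_mul_le (m : ℝ) (hm : 0 ≤ m) :
    (3 + Real.exp 1) * m ≤ Real.exp m + 5 := by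
  have h1 : Real.exp 1 < 2.7182818286 := Real.exp_one_lt_d9
  have h2 : 2.7182818283 < Real.exp 1 := Real.exp_one_gt_d9
  have h3 := Real.add_one_le_exp (m - 7 / 4)
  have h5 : Real.exp (7 / 4) ^ 4 = Real.exp 1 ^ 7 := by
    rw [← Real.exp_nat_mul, ← Real.exp_nat_mul]; norm_num
  have h6 : 5.73 < Real.exp (7 / 4) := by
    refine lt_of_pow_lt_pow_left₀ 4 (Real.exp_pos _).le ?_
    rw [h5]
    calc (5.73 : ℝ) ^ 4 < 2.7182818283 ^ 7 := by norm_num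
      _ < _ := by gcongr
  have h7 : Real.exp m = Real.exp (7 / 4) * Real.exp (m - 7 / 4) := by
    rw [← Real.exp_add]; congr 1; ring
  have h8 : Real.exp (7 / 4) < 5.76 := by
    refine lt_of_pow_lt_pow_left₀ 4 (by norm_num) ?_
    rw [h5]
    calc Real.exp 1 ^ 7 < 2.7182818286 ^ 7 := by gcongr
      _ < _ := by norm_num
  have h9 : Real.exp (7 / 4) * (m - 7 / 4 + 1) ≤ Real.exp m := by
    rw [h7]; gcongr
  have h10 : 0 ≤ (Real.exp (7 / 4) - 5.73) * m := mul_nonneg (by linarith) hm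
  have h11 : 0 ≤ (2.7182818286 - Real.exp 1) * m := mul_nonneg (by linarith) hm
  nlinarith

/-! ### Greedy clustering -/

section Greedy

variable {C : Type v} {K : Type w} {close : C → Finset K} {score : C → ℝ} {U T : Finset C}

theorem GreedyCenters.subset (h : GreedyCenters close score U T) : T ⊆ U := by
  induction h with
  | done => exact subset_rfl
  | step U T j hj hmin hT ih =>
    exact Finset.insert_subset hj
      (ih.trans ((Finset.filter_subset _ _).trans (Finset.erase_subset _ _)))

theorem GreedyCenters.pairwise_disjoint (h : GreedyCenters close score U T) :
    ∀ j ∈ T, ∀ j' ∈ T, j ≠ j' → Disjoint (close j) (close j') := by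
  induction h with
  | done => simp
  | step U T j hj hmin hT ih =>
    have hd : ∀ l ∈ T, Disjoint (close j) (close l) := fun l hl =>
      (Finset.mem_filter.1 (hT.subset hl)).2
    intro a ha b hb hab
    rcases Finset.mem_insert.1 ha with rfl | ha' <;> rcases Finset.mem_insert.1 hb with rfl | hb'
    · exact absurd rfl hab
    · exact hd _ hb'
    · exact (hd _ ha').symm
    · exact ih a ha' b hb' hab

/-- Every city shares a close facility with a cluster center whose score is no larger. -/
theorem GreedyCenters.exists_center (h : GreedyCenters close score U T)
    (hne : ∀ j, (close j).Nonempty) :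
    ∀ j ∈ U, ∃ j' ∈ T, score j' ≤ score j ∧ ¬ Disjoint (close j') (close j) := by
  induction h with
  | done => simp
  | step U T l hl hmin hT ih =>
    intro j hj
    by_cases hd : Disjoint (close l) (close j)
    · have hjl : j ≠ l := by
        rintro rfl
        exact (hne j).ne_empty (Finset.disjoint_self_iff_empty _ |>.1 hd)
      obtain ⟨j', hj', h1, h2⟩ :=
        ih j (Finset.mem_filter.2 ⟨Finset.mem_erase.2 ⟨hjl, hj⟩, hd⟩)
      exact ⟨j', Finset.mem_insert_of_mem hj', h1, h2⟩
    · exact ⟨l, Finset.mem_insert_self _ _, hmin j hj, hd⟩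

end Greedy

namespace CSRun

variable {F : Type u} {C : Type v} [Fintype F] [Fintype C] {I : Instance F C} {γ : ℝ}
  {K : Type w} [Fintype K] (R : CSRun I γ K)

/-! ### Close facilities -/

theorem mem_closeSet {k : K} {j : C} : k ∈ closeSet R.xbar j ↔ 0 < R.xbar k j := by
  simp [closeSet]

theorem xbar_eq_ybar {k : K} {j : C} (h : k ∈ closeSet R.xbar j) : R.xbar k j = R.ybar k :=
  R.complete k j (R.mem_closeSet.1 h)

theorem ybar_pos {k : K} {j : C} (h : k ∈ closeSet R.xbar j) : 0 < R.ybar k :=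
  R.xbar_eq_ybar h ▸ R.mem_closeSet.1 h

theorem sum_ybar_closeSet (j : C) : ∑ k ∈ closeSet R.xbar j, R.ybar k = 1 := by
  rw [← R.xbar_sum j, ← Finset.sum_congr rfl fun k hk => R.xbar_eq_ybar hk]
  refine Finset.sum_subset (Finset.subset_univ _) fun k _ hk => ?_
  exact le_antisymm (not_lt.1 fun h => hk (R.mem_closeSet.2 h)) (R.xbar_nonneg _ _)

theorem closeSet_nonempty (j : C) : (closeSet R.xbar j).Nonempty := by
  by_contra h
  have := R.sum_ybar_closeSet j
  rw [Finset.not_nonempty_iff_eq_empty.1 h] at this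
  simp at this

theorem closeSet_disjoint {j j' : C} (hj : j ∈ R.centers) (hj' : j' ∈ R.centers) (h : j ≠ j') :
    Disjoint (closeSet R.xbar j) (closeSet R.xbar j') :=
  R.greedy.pairwise_disjoint j hj j' hj' h

/-! ### The law of the open facilities -/

theorem expectation_eq_sum (X : R.Outcome → ℝ) : R.expectation X = ∑ ω, R.prob ω * X ω := by
  unfold expectation
  rw [PMF.integral_eq_sum]
  refine Finset.sum_congr rfl fun ω _ => ?_
  simp [law, ENNReal.toReal_ofReal (R.prob_nonneg ω)]

theorem expectation_mono {X Y : R.Outcome → ℝ} (h : ∀ ω, X ω ≤ Y ω) :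
    R.expectation X ≤ R.expectation Y := by
  simp only [expectation_eq_sum]
  exact Finset.sum_le_sum fun ω _ => mul_le_mul_of_nonneg_left (h ω) (R.prob_nonneg ω)

/-- The probability that no copy in `S` is open. -/
def probClosed (S : Finset K) : ℝ :=
  ∑ ω, R.prob ω * (if Disjoint (R.openCopies ω) S then 1 else 0)

/-- The choices are independent, so that every cluster and every unclustered copy contributes a
factor. -/
theorem probClosed_eq (S : Finset K) : R.probClosed S =
    (∏ l : {l // l ∈ R.centers}, (1 - ∑ k ∈ S ∩ closeSet R.xbar l.1, R.ybar k)) *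
      ∏ k : {k // k ∈ R.unclustered}, (if k.1 ∈ S then 1 - R.ybar k.1 else 1) := by
  have hind : ∀ ω : R.Outcome, (if Disjoint (R.openCopies ω) S then (1 : ℝ) else 0)
      = (∏ l, if (ω.1 l).1 ∈ S then (0 : ℝ) else 1) *
        ∏ k : {k // k ∈ R.unclustered}, (if ω.2 k = true ∧ k.1 ∈ S then (0 : ℝ) else 1) := by
    intro ω
    split_ifs with h
    · rw [Finset.disjoint_left] at h
      rw [Finset.prod_eq_one, Finset.prod_eq_one, one_mul]
      · rintro k -
        refine if_neg fun hk => h ?_ hk.2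
        exact Finset.mem_filter.2 ⟨Finset.mem_univ _, Or.inr ⟨k.2, hk.1⟩⟩
      · rintro l -
        exact if_neg (h (Finset.mem_filter.2 ⟨Finset.mem_univ _, Or.inl ⟨l, rfl⟩⟩))
    · obtain ⟨k, hk, hkS⟩ := Finset.not_disjoint_iff.1 h
      symm
      rcases (Finset.mem_filter.1 hk).2 with ⟨l, rfl⟩ | ⟨hu, ho⟩
      · have h0 : (∏ l, if (ω.1 l).1 ∈ S then (0 : ℝ) else 1) = 0 :=
          Finset.prod_eq_zero (Finset.mem_univ l) (if_pos hkS)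
        rw [h0, zero_mul]
      · have h0 : (∏ k : {k // k ∈ R.unclustered},
            (if ω.2 k = true ∧ k.1 ∈ S then (0 : ℝ) else 1)) = 0 :=
          Finset.prod_eq_zero (Finset.mem_univ ⟨k, hu⟩) (if_pos ⟨ho, hkS⟩)
        rw [h0, mul_zero]
  have h1 : ∀ l : {l // l ∈ R.centers},
      ∑ k : {k // k ∈ closeSet R.xbar l.1}, R.xbar k.1 l.1 * (if k.1 ∈ S then 0 else 1)
        = 1 - ∑ k ∈ S ∩ closeSet R.xbar l.1, R.ybar k := by
    intro l
    rw [Finset.sum_coe_sort (closeSet R.xbar l.1)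
      (fun k => R.xbar k l.1 * (if k ∈ S then 0 else 1)),
      Finset.inter_comm, ← Finset.filter_mem_eq_inter, Finset.sum_filter,
      eq_sub_iff_add_eq, ← Finset.sum_add_distrib]
    refine Eq.trans ?_ (R.sum_ybar_closeSet l.1)
    refine Finset.sum_congr rfl fun k hk => ?_
    rw [R.xbar_eq_ybar hk]
    split_ifs <;> simp
  have h2 : ∀ k : {k // k ∈ R.unclustered},
      ∑ b : Bool, (if b then R.ybar k.1 else 1 - R.ybar k.1) *
        (if b = true ∧ k.1 ∈ S then 0 else 1) = if k.1 ∈ S then 1 - R.ybar k.1 else 1 := by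
    intro k
    by_cases hk : k.1 ∈ S <;> simp [hk]
  simp only [← h1, ← h2]
  rw [Fintype.prod_sum (fun (l : {l // l ∈ R.centers})
      (k : {k // k ∈ closeSet R.xbar l.1}) => R.xbar k.1 l.1 * (if k.1 ∈ S then 0 else 1)),
    Fintype.prod_sum (fun (k : {k // k ∈ R.unclustered}) (b : Bool) =>
      (if b then R.ybar k.1 else 1 - R.ybar k.1) * (if b = true ∧ k.1 ∈ S then 0 else 1)),
    Finset.sum_mul_sum, probClosed, ← Finset.sum_product']
  refine Finset.sum_congr (by ext; simp) fun ω _ => ?_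
  rw [hind ω, prob]
  simp only [Finset.prod_mul_distrib]
  ring

/-- A copy is open with probability `ybar`. -/
theorem probClosed_singleton (k : K) : R.probClosed {k} = 1 - R.ybar k := by
  rw [probClosed_eq]
  by_cases hk : k ∈ R.unclustered
  · rw [Finset.prod_eq_one, one_mul, Finset.prod_eq_single ⟨k, hk⟩]
    · simp
    · intro b _ hb
      exact if_neg fun h => hb (Subtype.ext (Finset.mem_singleton.1 h))
    · simp
    · intro l _
      have : k ∉ closeSet R.xbar l.1 := (Finset.mem_filter.1 hk).2 l.1 l.2
      simp [Finset.singleton_inter_of_notMem this]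
  · obtain ⟨j, hj, hkj⟩ : ∃ j ∈ R.centers, k ∈ closeSet R.xbar j := by
      simpa [unclustered] using hk
    have h2 : ∏ u : {k // k ∈ R.unclustered},
        (if u.1 ∈ ({k} : Finset K) then 1 - R.ybar u.1 else 1) = 1 :=
      Finset.prod_eq_one fun u _ => if_neg fun h => hk (by
        rw [← Finset.mem_singleton.1 h]; exact u.2)
    rw [h2, mul_one, Finset.prod_eq_single ⟨j, hj⟩]
    · simp [Finset.singleton_inter_of_mem hkj]
    · intro l _ hl
      have : k ∉ closeSet R.xbar l.1 := fun h =>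
        Finset.disjoint_left.1 (R.closeSet_disjoint l.2 hj fun h => hl (Subtype.ext h)) h hkj
      simp [Finset.singleton_inter_of_notMem this]
    · simp

/-- The key probability estimate: the cluster of one center is accounted for exactly, everything
else through `1 - t ≤ exp (-t)`. -/
theorem probClosed_le {j : C} (hj : j ∈ R.centers) (S : Finset K) :
    R.probClosed S ≤ (1 - ∑ k ∈ S ∩ closeSet R.xbar j, R.ybar k) *
      Real.exp (-∑ k ∈ S \ closeSet R.xbar j, R.ybar k) := by
  have hle1 : ∀ l, ∑ k ∈ S ∩ closeSet R.xbar l, R.ybar k ≤ 1 := fun l => by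
    rw [← R.sum_ybar_closeSet l]
    exact Finset.sum_le_sum_of_subset_of_nonneg Finset.inter_subset_right
      fun k _ _ => R.ybar_nonneg k
  have hpart : ∑ k ∈ S \ closeSet R.xbar j, R.ybar k =
      ∑ l ∈ Finset.univ.erase (⟨j, hj⟩ : {l // l ∈ R.centers}),
        ∑ k ∈ S ∩ closeSet R.xbar l.1, R.ybar k +
      ∑ k : {k // k ∈ R.unclustered}, if k.1 ∈ S then R.ybar k.1 else 0 := by
    have hdisj : ((Finset.univ.erase (⟨j, hj⟩ : {l // l ∈ R.centers}) : Finset _) :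
        Set {l // l ∈ R.centers}).PairwiseDisjoint fun l => S ∩ closeSet R.xbar l.1 := by
      intro a _ b _ hab
      exact (R.closeSet_disjoint a.2 b.2 fun h => hab (Subtype.ext h)).mono
        Finset.inter_subset_right Finset.inter_subset_right
    rw [← Finset.sum_biUnion hdisj,
      Finset.sum_coe_sort R.unclustered (fun k => if k ∈ S then R.ybar k else 0),
      ← Finset.sum_filter, ← Finset.sum_union]
    · refine Finset.sum_congr ?_ fun _ _ => rfl
      ext k
      simp only [Finset.mem_sdiff, Finset.mem_union, Finset.mem_biUnion, Finset.mem_erase,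
        Finset.mem_univ, and_true, Finset.mem_inter, Finset.mem_filter]
      constructor
      · rintro ⟨hkS, hkj⟩
        by_cases hu : k ∈ R.unclustered
        · exact Or.inr ⟨hu, hkS⟩
        · obtain ⟨l, hl, hkl⟩ : ∃ l ∈ R.centers, k ∈ closeSet R.xbar l := by
            simpa [unclustered] using hu
          refine Or.inl ⟨⟨l, hl⟩, fun h => hkj ?_, hkS, hkl⟩
          rwa [← show l = j from congrArg Subtype.val h]
      · rintro (⟨l, hl, hkS, hkl⟩ | ⟨hu, hkS⟩)
        · exact ⟨hkS, fun h => Finset.disjoint_left.1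
            (R.closeSet_disjoint l.2 hj fun h => hl (Subtype.ext h)) hkl h⟩
        · exact ⟨hkS, (Finset.mem_filter.1 hu).2 j hj⟩
    · rw [Finset.disjoint_left]
      intro k hk hk'
      obtain ⟨l, _, hl⟩ := Finset.mem_biUnion.1 hk
      exact (Finset.mem_filter.1 (Finset.mem_filter.1 hk').1).2 l.1 l.2 (Finset.mem_inter.1 hl).2
  rw [probClosed_eq, ← Finset.mul_prod_erase _ _ (Finset.mem_univ (⟨j, hj⟩ : {l // l ∈ R.centers})),
    mul_assoc, hpart, neg_add, Real.exp_add, ← Finset.sum_neg_distrib, ← Finset.sum_neg_distrib,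
    Real.exp_sum, Real.exp_sum]
  refine mul_le_mul_of_nonneg_left ?_ (sub_nonneg.2 (hle1 j))
  refine mul_le_mul ?_ ?_ ?_ ?_
  · exact Finset.prod_le_prod (fun l _ => sub_nonneg.2 (hle1 l.1))
      fun l _ => Real.one_sub_le_exp_neg _
  · refine Finset.prod_le_prod (fun k _ => ?_) fun k _ => ?_
    · split_ifs
      exacts [sub_nonneg.2 (R.ybar_le_one _), zero_le_one]
    · split_ifs
      exacts [Real.one_sub_le_exp_neg _, by simp]
  · refine Finset.prod_nonneg fun k _ => ?_
    split_ifs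
    exacts [sub_nonneg.2 (R.ybar_le_one _), zero_le_one]
  · exact Finset.prod_nonneg fun l _ => (Real.exp_pos _).le

/-! ### Opening costs -/

theorem expectation_facilityCost (i : F) :
    R.expectation (fun ω => R.facilityCost ω i) = γ * (R.ys i * I.f i) := by
  have hopen : ∀ k, ∑ ω, R.prob ω * (if k ∈ R.openCopies ω then 1 else 0) = R.ybar k := by
    intro k
    have h1 := R.probClosed_singleton k
    have h2 := R.sum_prob
    have h3 : R.probClosed {k} + ∑ ω, R.prob ω * (if k ∈ R.openCopies ω then 1 else 0)
        = ∑ ω, R.prob ω := by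
      rw [probClosed, ← Finset.sum_add_distrib]
      refine Finset.sum_congr rfl fun ω _ => ?_
      by_cases h : k ∈ R.openCopies ω <;> simp [h]
    linarith
  have hcost : ∀ ω, R.facilityCost ω i = ∑ k ∈ Finset.univ.filter (fun k => R.orig k = i),
      (if k ∈ R.openCopies ω then 1 else 0) * I.f i := by
    intro ω
    rw [facilityCost, Finset.sum_filter, ← Finset.univ_inter (R.openCopies ω),
      ← Finset.filter_mem_eq_inter, Finset.sum_filter]
    refine Finset.sum_congr rfl fun k _ => ?_
    by_cases h1 : k ∈ R.openCopies ω <;> by_cases h2 : R.orig k = i <;> simp [h1, h2]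
  simp only [expectation_eq_sum, hcost, Finset.mul_sum]
  rw [Finset.sum_comm, ← mul_assoc, ← R.ybar_sum i, Finset.sum_mul]
  refine Finset.sum_congr rfl fun k _ => ?_
  rw [← hopen k, Finset.sum_mul]
  exact Finset.sum_congr rfl fun ω _ => by ring

theorem openVar_mul_le_facilityCost (ω : R.Outcome) (i : F) :
    R.openVar ω i * I.f i ≤ R.facilityCost ω i := by
  have hnn : ∀ k ∈ R.openCopies ω, 0 ≤ if R.orig k = i then I.f i else 0 := by
    intro k _
    split_ifs
    exacts [I.f_nonneg i, le_rfl]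
  unfold openVar facilityCost
  split_ifs with h
  · obtain ⟨k, hk, hki⟩ := Finset.mem_image.1 h
    refine le_trans ?_ (Finset.single_le_sum hnn hk)
    simp [hki]
  · rw [zero_mul]
    exact Finset.sum_nonneg hnn

/-! ### Connections -/

theorem connectionCost_le {ω : R.Outcome} {k : K} (hk : k ∈ R.openCopies ω) (j : C) :
    R.connectionCost ω j ≤ I.c (R.orig k) j :=
  csInf_le ((Set.toFinite _).bddBelow)
    ⟨R.orig k, Finset.mem_coe.2 (Finset.mem_image_of_mem _ hk), rfl⟩

theorem mem_openCopies_center (ω : R.Outcome) (l : {l // l ∈ R.centers}) :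
    (ω.1 l).1 ∈ R.openCopies ω :=
  Finset.mem_filter.2 ⟨Finset.mem_univ _, Or.inl ⟨l, rfl⟩⟩

theorem exists_center (j : C) : ∃ j' ∈ R.centers,
    avgDist (fun k j => I.c (R.orig k) j) R.ybar j' (closeSet R.xbar j')
      + maxDist (fun k j => I.c (R.orig k) j) j' (closeSet R.xbar j') ≤
    avgDist (fun k j => I.c (R.orig k) j) R.ybar j (closeSet R.xbar j)
      + maxDist (fun k j => I.c (R.orig k) j) j (closeSet R.xbar j) ∧
    ∃ k ∈ closeSet R.xbar j', k ∈ closeSet R.xbar j := by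
  obtain ⟨j', hj', h1, h2⟩ :=
    R.greedy.exists_center (fun j => R.closeSet_nonempty j) j (Finset.mem_univ j)
  exact ⟨j', hj', h1, Finset.not_disjoint_iff.1 h2⟩

theorem exists_connectionCost_eq (ω : R.Outcome) (j : C) :
    ∃ k ∈ R.openCopies ω, I.c (R.orig k) j = R.connectionCost ω j := by
  obtain ⟨l, hl, -⟩ := R.exists_center j
  have hne : ((fun i => I.c i j) '' (R.openFacilities ω : Set F)).Nonempty :=
    ⟨_, R.orig (ω.1 ⟨l, hl⟩).1, Finset.mem_coe.2 (Finset.mem_image_of_mem _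
      (R.mem_openCopies_center ω ⟨l, hl⟩)), rfl⟩
  obtain ⟨i, hi, h⟩ := hne.csInf_mem (Set.toFinite _)
  obtain ⟨k, hk, rfl⟩ := Finset.mem_image.1 (Finset.mem_coe.1 hi)
  exact ⟨k, hk, h⟩

theorem connectionCost_nonneg (ω : R.Outcome) (j : C) : 0 ≤ R.connectionCost ω j := by
  obtain ⟨k, -, hk⟩ := R.exists_connectionCost_eq ω j
  exact hk ▸ I.c_nonneg _ _

theorem exists_integral_feasible (ω : R.Outcome) :
    ∃ x : F → C → ℝ, (∀ i j, x i j = 0 ∨ x i j = 1) ∧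
      I.LPFeasible x (R.openVar ω) ∧ ∀ j, ∑ i, x i j * I.c i j = R.connectionCost ω j := by
  choose k hk hkj using R.exists_connectionCost_eq ω
  refine ⟨fun i j => if i = R.orig (k j) then 1 else 0, fun i j => ?_, ⟨?_, ?_, ?_, ?_⟩, ?_⟩
  · dsimp only; split_ifs <;> simp
  · intro j; simp
  · intro i j
    split_ifs with h
    · rw [openVar, if_pos (h ▸ Finset.mem_image_of_mem _ (hk j))]
    · unfold openVar; split_ifs <;> norm_num
  · intro i j; split_ifs <;> norm_num
  · intro i; unfold openVar; split_ifs <;> norm_num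
  · intro j; simp [hkj]

theorem lt_connectionCost_iff (ω : R.Outcome) (j : C) (τ : ℝ) : τ < R.connectionCost ω j ↔
    Disjoint (R.openCopies ω) (Finset.univ.filter fun k => I.c (R.orig k) j ≤ τ) := by
  rw [Finset.disjoint_left]
  constructor
  · intro h k hk hkτ
    exact absurd ((R.connectionCost_le hk j).trans (Finset.mem_filter.1 hkτ).2) (not_le.2 h)
  · intro h
    obtain ⟨k, hk, hkj⟩ := R.exists_connectionCost_eq ω j
    rw [← hkj]
    by_contra hle
    exact h hk (Finset.mem_filter.2 ⟨Finset.mem_univ _, not_lt.1 hle⟩)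

end CSRun

/-! ### Choice of the coefficients -/

/-- Coefficients `A₂ = A₃` and `A₄ = exp (v - M)` for the layer cake estimate: all the distant
facilities are merged, whether they lie in the cluster of the center or not. Here `v`, `y` and `r`
are the fractions of the cluster that are close, distant and neither, and `M` is the weight of the
distant facilities outside the cluster. The left side is convex in `W` and affine in `p` and `q`, so
that only the vertices of a box matter. -/
theorem merged_coefficients {v y r M W p q : ℝ} (hv : 0 ≤ v) (hr : 0 ≤ r)
    (hsum : v + y + r = 1) (hW : 0 ≤ W) (hWM : W ≤ M) (hp : 0 ≤ p) (hpy : p ≤ y)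
    (hq0 : 0 ≤ q) (hqr : q ≤ r) :
    (M + y) * (Real.exp v * Real.exp (-W) * (p + q)) ≤
      (1 - Real.exp (-M) * Real.exp v * r) * (M - W + p)
        + (M + y) * (Real.exp (-M) * Real.exp v * q) := by
  set E := Real.exp (-M) with hE
  set G := Real.exp v with hG
  have hGpos : 0 < G := Real.exp_pos _
  have hEpos : 0 < E := Real.exp_pos _
  have hM : 0 ≤ M := hW.trans hWM
  have hy : 0 ≤ y := hp.trans hpy
  have hG1 : G * (1 - v) ≤ 1 := exp_mul_one_sub_le_one v
  have hE1 : E ≤ 1 := Real.exp_le_one_iff.2 (by linarith)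
  rcases hM.eq_or_lt with rfl | hMpos
  · have hW0 : W = 0 := le_antisymm hWM hW
    have hE' : E = 1 := by simp [hE]
    have hGr : G * (y + r) ≤ 1 := by rw [show y + r = 1 - v by linarith]; exact hG1
    rw [hW0, hE']
    simp only [neg_zero, Real.exp_zero]
    nlinarith
  have hchord := exp_neg_chord hW hWM
  rw [← hE] at hchord
  -- `hA`, `hsy`, `hB` and `hC` give the inequality at the vertices of the box for `W` and `p`.
  have hA : G * E * (M + 1 - v) ≤ 1 := by
    have h := exp_mul_one_sub_le_one (v - M)
    rw [sub_eq_add_neg, Real.exp_add] at h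
    rw [hG, hE]; linarith
  have hsy : G * r ≤ 1 - y := by
    have h1 : r ≤ (1 - v) * (1 - y) := by nlinarith
    calc G * r ≤ G * ((1 - v) * (1 - y)) := by gcongr
      _ = (G * (1 - v)) * (1 - y) := by ring
      _ ≤ 1 * (1 - y) := by gcongr; linarith
      _ = 1 - y := one_mul _
  have hEM : 1 - M ≤ E := Real.one_sub_le_exp_neg M
  have hB : G * r * (M + y - y * E) ≤ M := by
    have h1 : M + y - y * E ≤ M * (1 + y) := by nlinarith
    have h2 : 0 ≤ M + y - y * E := by nlinarith
    calc G * r * (M + y - y * E) ≤ (1 - y) * (M * (1 + y)) := by gcongr; linarith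
      _ ≤ M := by nlinarith [mul_nonneg hM (mul_nonneg hy hy)]
  have hC : G * (y + r) ≤ 1 := by rw [show y + r = 1 - v by linarith]; exact hG1
  set N := M - W with hN
  have hN0 : 0 ≤ N := sub_nonneg.2 hWM
  -- the edge `W = 0`
  have hedge : (M + y) * (G * (p + r)) - (M + y) * (G * E * r) ≤
      (1 - E * G * r) * (M + p) := by
    rcases hy.eq_or_lt with rfl | hypos
    · have : p = 0 := le_antisymm hpy hp
      subst this
      nlinarith
    · have h0 : (M + y) * (G * (0 + r)) - (M + y) * (G * E * r) ≤ (1 - E * G * r) * (M + 0) := by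
        nlinarith
      have h1 : (M + y) * (G * (y + r)) - (M + y) * (G * E * r) ≤
          (1 - E * G * r) * (M + y) := by nlinarith
      have h2 := add_le_add (mul_le_mul_of_nonneg_left h0 (sub_nonneg.2 hpy))
        (mul_le_mul_of_nonneg_left h1 hp)
      refine le_of_mul_le_mul_left ?_ hypos
      linarith
  -- the edge `W = M`
  have hedge' : (M + y) * (G * E * p) ≤ (1 - E * G * r) * p := by
    have : G * E * (M + y + r) ≤ 1 := by
      rw [show M + y + r = M + 1 - v by linarith]; exact hA
    nlinarith [mul_le_mul_of_nonneg_right this hp]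
  have hNM : 0 ≤ M - N := by rw [hN]; linarith
  have hexp : M * Real.exp (-W) ≤ N + (M - N) * E := by
    rw [hN]; rw [hN] at hchord; linarith
  have hq : (N * (1 - E)) * q ≤ (N * (1 - E)) * r :=
    mul_le_mul_of_nonneg_left hqr (mul_nonneg hN0 (by linarith))
  refine le_of_mul_le_mul_left ?_ hMpos
  have hMy : 0 ≤ M + y := by linarith
  have h1 := mul_le_mul_of_nonneg_right hexp
    (mul_nonneg (mul_nonneg hMy hGpos.le) (add_nonneg hp hq0))
  have h2 := mul_le_mul_of_nonneg_left hq (mul_nonneg hMy hGpos.le)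
  have h3 := mul_le_mul_of_nonneg_left hedge hN0
  have h4 := mul_le_mul_of_nonneg_left hedge' hNM
  linarith

/-- Coefficients `A₂ = (1 - exp (-M)) / M` and `A₃ = A₄ = exp (v - M)` for the layer cake estimate:
the distant facilities outside the cluster come first, and the whole cluster serves as a fallback.
They are preferable when the distant facilities in the cluster are farther away than average. -/
theorem split_coefficients {v y r M W p q : ℝ} (hsum : v + y + r = 1) (hM : 0 < M) (hW : 0 ≤ W)
    (hWM : W ≤ M) (hpy : p ≤ y) (hqr : q ≤ r) :
    Real.exp v * Real.exp (-W) * (p + q) ≤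
      (1 - Real.exp (-M)) / M * (M - W) + Real.exp (-M) * Real.exp v * p
        + Real.exp (-M) * Real.exp v * q := by
  have hchord := exp_neg_chord hW hWM
  have hE : Real.exp (-W) - Real.exp (-M) ≤ (1 - Real.exp (-M)) / M * (M - W) := by
    rw [div_mul_eq_mul_div, le_div_iff₀ hM]; linarith
  have hE0 : 0 ≤ Real.exp (-W) - Real.exp (-M) := sub_nonneg.2 (Real.exp_le_exp.2 (by linarith))
  have hG : Real.exp v * (p + q) ≤ 1 :=
    (mul_le_mul_of_nonneg_left (by linarith : p + q ≤ 1 - v) (Real.exp_pos v).le).trans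
      (exp_mul_one_sub_le_one v)
  have := mul_le_mul_of_nonneg_right hG hE0
  linarith

/-- A bound on the average distance `U` of the city to the unused part of the cluster, when `h`,
`a`, `g` are the average distances of the center to the parts of its cluster that are close,
unused and distant for the city. The two bounds on `U` go through a close and through a distant
facility of the city; `dm + l` and `dm + l + δ` are the average distances to the distant
facilities outside and inside the cluster. -/
theorem center_distance_le {v y r ρ dc dm X h a g l δ U : ℝ} (hy : 0 ≤ y) (hr : 0 ≤ r)
    (hsum : v + y + r = 1) (hrρ : r ≤ ρ) (hρ1 : ρ ≤ 1) (hdm : 0 ≤ dm) (hhX : h ≤ X) (haX : a ≤ X)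
    (hh0 : 0 ≤ h) (ha0 : 0 ≤ a) (hg0 : 0 ≤ g) (hgY : g ≤ v * h + y * g + r * a)
    (hl0 : 0 ≤ l) (hδ0 : 0 ≤ δ) (hscore : v * h + y * g + r * a + X ≤ dc + dm)
    (hU : U ≤ 3 * (a + h + dm)) (hU' : U ≤ 3 * (a + g + (dm + l + δ))) (hy1 : y ≤ 1) :
    ρ * (U - dm) ≤ 3 * dc + 5 * dm + 5 * l + 3 * (y * δ) := by
  have hρ0 : 0 ≤ ρ := hr.trans hrρ
  have hX : 0 ≤ X := hh0.trans hhX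
  have hρX : ρ * X ≤ X := mul_le_of_le_one_left hX hρ1
  -- A convex combination of the two bounds on `U`, with weight `y / ρ` on the second if possible.
  rcases le_total y ρ with hyρ | hyρ
  · have h1 : (ρ - y) * (U - dm) ≤ (ρ - y) * (3 * (a + h) + 2 * dm) :=
      mul_le_mul_of_nonneg_left (by linarith) (sub_nonneg.2 hyρ)
    have h2 : y * (U - dm) ≤ y * (3 * (a + g + l + δ) + 2 * dm) :=
      mul_le_mul_of_nonneg_left (by linarith) hy
    have h3 : ρ * (a + h) ≤ X + (v + y) * h + r * a := by
      have h4 : (ρ - r) * a ≤ (ρ - r) * X := mul_le_mul_of_nonneg_left haX (by linarith)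
      have h7 : (v + y + r) * X = X := by rw [hsum, one_mul]
      rcases le_total (v + y) ρ with h5 | h5
      · have h6 : (ρ - (v + y)) * h ≤ (ρ - (v + y)) * X :=
          mul_le_mul_of_nonneg_left hhX (by linarith)
        linarith
      · have h6 : 0 ≤ (v + y - ρ) * h := mul_nonneg (by linarith) hh0
        have h8 : 0 ≤ r * X := mul_nonneg hr hX
        linarith
    have h4 : y * l ≤ 1 * l := mul_le_mul_of_nonneg_right hy1 hl0
    have h5 : ρ * dm ≤ 1 * dm := mul_le_mul_of_nonneg_right hρ1 hdm
    linarith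
  · have h2 : ρ * (U - dm) ≤ ρ * (3 * (a + g + l + δ) + 2 * dm) :=
      mul_le_mul_of_nonneg_left (by linarith) hρ0
    have h3 : ρ * (3 * (a + g + l) + 2 * dm) ≤ 1 * (3 * (a + g + l) + 2 * dm) :=
      mul_le_mul_of_nonneg_right hρ1 (by positivity)
    have h4 : ρ * δ ≤ y * δ := mul_le_mul_of_nonneg_right hyρ hδ0
    linarith

/-- The bound on the expected connection cost `T` from the layer cake estimate `hT`. The sums
`SL`, `Sb`, `SU` are the distances of the city to the distant facilities outside the cluster and
inside it, and to the unused part of the cluster, with total weights `M`, `y`, `r`; the sums `Sh`,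
`Sg`, `Sa` are the distances of the center to the close, distant and unused part of its cluster. The
merged coefficients suffice when the unused part is not too far away, and the split ones otherwise,
because then the distant facilities in the cluster are farther away than average. -/
theorem cost_le_of_coefficients {v y r M dc dm SL Sb SU X Sh Sg Sa T : ℝ}
    (hv : 0 < v) (hy : 0 ≤ y) (hr : 0 ≤ r) (hM : 0 ≤ M) (hsum : v + y + r = 1) (hm : 0 < M + y)
    (hdc : 0 ≤ dc) (hdm : 0 ≤ dm) (hL : M * dm ≤ SL) (hb : y * dm ≤ Sb)
    (hh0 : 0 ≤ Sh) (ha0 : 0 ≤ Sa) (hg0 : 0 ≤ Sg)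
    (hh : Sh ≤ v * X) (hg : Sg ≤ y * X) (ha : Sa ≤ r * X)
    (hscore : Sh + Sg + Sa + X ≤ dc + dm)
    (hU : v * SU ≤ 3 * (v * Sa + r * Sh + r * v * dm))
    (hU' : y * SU ≤ 3 * (y * Sa + r * Sg + r * Sb))
    (hT : ∀ A₂ A₃ A₄ : ℝ,
      (∀ W p q, 0 ≤ W → W ≤ M → 0 ≤ p → p ≤ y → 0 ≤ q → q ≤ r →
        Real.exp v * Real.exp (-W) * (p + q) ≤ A₂ * (M - W) + A₃ * p + A₄ * q) →
      T ≤ (1 - Real.exp (-1)) * dc + Real.exp (-1) *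
        (dm * (1 - A₂ * M - A₃ * y - A₄ * r) + A₂ * SL + A₃ * Sb + A₄ * SU)) :
    T ≤ (1 - Real.exp (-1) + 3 * Real.exp (-(M + y + 1))) * dc +
      (Real.exp (-1) + 5 * Real.exp (-(M + y + 1))) * ((SL + Sb) / (M + y)) := by
  set dd := (SL + Sb) / (M + y) with hdd
  set P := Real.exp (-(M + y)) with hP
  have hPpos : 0 < P := Real.exp_pos _
  have hPe : Real.exp (-(M + y + 1)) = Real.exp (-1) * P := by
    rw [hP, ← Real.exp_add]; congr 1; ring
  have hddm : (M + y) * dd = SL + Sb := by rw [hdd]; field_simp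
  have hdmdd : dm ≤ dd := by
    refine le_of_mul_le_mul_left ?_ hm
    rw [hddm]; linarith
  rw [hPe]
  set ρ := Real.exp (v + y) * r with hρ
  have hρ0 : 0 ≤ ρ := mul_nonneg (Real.exp_pos _).le hr
  have hρ1 : ρ ≤ 1 := by
    rw [hρ, show r = 1 - (v + y) by linarith]; exact exp_mul_one_sub_le_one _
  have hEP : Real.exp (-M) * Real.exp v = P * Real.exp (v + y) := by
    rw [hP, ← Real.exp_add, ← Real.exp_add]; congr 1; ring
  have hθ : Real.exp (-M) * Real.exp v * r = P * ρ := by rw [hEP, hρ]; ring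
  have he := Real.exp_pos (-1)
  suffices hgoal : T ≤ (1 - Real.exp (-1)) * dc + Real.exp (-1) *
      (dd + P * (3 * dc + 5 * dd)) by
    refine hgoal.trans (le_of_eq ?_); ring
  by_cases hcase : SU ≤ r * (3 * dc + 6 * dd)
  -- With these coefficients that of `dm` vanishes.
  · refine (hT ((1 - P * ρ) / (M + y)) ((1 - P * ρ) / (M + y)) (P * Real.exp (v + y)) ?_).trans ?_
    · intro W p q hW hWM hp hpy hq hqr
      have h := merged_coefficients hv.le hr hsum hW hWM hp hpy hq hqr
      rw [hθ, hEP] at h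
      refine le_of_mul_le_mul_left (h.trans (le_of_eq ?_)) hm
      field_simp
    · have h1 : 1 - (1 - P * ρ) / (M + y) * M - (1 - P * ρ) / (M + y) * y
          - P * Real.exp (v + y) * r = 0 := by
        rw [mul_assoc P, ← hρ]; field_simp; ring
      have h2 : (1 - P * ρ) / (M + y) * SL + (1 - P * ρ) / (M + y) * Sb = (1 - P * ρ) * dd := by
        rw [hdd]; field_simp
      have h3 : P * Real.exp (v + y) * SU ≤ P * ρ * (3 * dc + 6 * dd) := by
        calc _ ≤ P * Real.exp (v + y) * (r * (3 * dc + 6 * dd)) := by gcongr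
          _ = _ := by rw [hρ]; ring
      have h4 : P * ρ * (3 * dc + 5 * dd) ≤ P * 1 * (3 * dc + 5 * dd) := by
        have : 0 ≤ dd := hdm.trans hdmdd
        gcongr
      rw [h1]
      refine add_le_add le_rfl (mul_le_mul_of_nonneg_left ?_ he.le)
      linarith
  -- Otherwise the unused part of the cluster is so far away that the path through the close
  -- facilities, or through distant facilities at average distance `dd`, is too long.
  push Not at hcase
  have hrpos : 0 < r := by
    refine lt_of_le_of_ne hr fun h => ?_
    rw [← h] at hcase ha hU
    have : SU ≤ 0 := by
      refine le_of_mul_le_mul_left (hU.trans ?_) hv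
      nlinarith
    linarith
  obtain ⟨h, hhd⟩ : ∃ h, Sh = v * h := ⟨Sh / v, by field_simp⟩
  obtain ⟨a, had⟩ : ∃ a, Sa = r * a := ⟨Sa / r, by field_simp⟩
  obtain ⟨U, hUd⟩ : ∃ U, SU = r * U := ⟨SU / r, by field_simp⟩
  subst hhd had hUd
  have hhX : h ≤ X := le_of_mul_le_mul_left hh hv
  have haX : a ≤ X := le_of_mul_le_mul_left ha hrpos
  have hh0' : 0 ≤ h := nonneg_of_mul_nonneg_right hh0 hv
  have ha0' : 0 ≤ a := nonneg_of_mul_nonneg_right ha0 hrpos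
  have hU1 : U ≤ 3 * (a + h + dm) := by
    refine le_of_mul_le_mul_left ?_ (mul_pos hv hrpos); linarith
  have hUbig : 3 * dc + 6 * dd < U := lt_of_mul_lt_mul_left hcase hr
  have hhY : v * h + Sg + r * a < h := by
    by_contra hle; push Not at hle; linarith
  have haY : v * h + Sg + r * a < a := by
    by_contra hle; push Not at hle; linarith
  have hypos : 0 < y := by
    refine lt_of_le_of_ne hy fun hy0 => ?_
    rw [← hy0] at hsum
    have h1 := mul_lt_mul_of_pos_left hhY hv
    have h2 := mul_lt_mul_of_pos_left haY hrpos
    have h3 : (v + r) * (v * h + Sg + r * a) = v * h + Sg + r * a := by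
      rw [show v + r = 1 by linarith, one_mul]
    linarith
  obtain ⟨g, hgd⟩ : ∃ g, Sg = y * g := ⟨Sg / y, by field_simp⟩
  obtain ⟨b, hbd⟩ : ∃ b, Sb = y * b := ⟨Sb / y, by field_simp⟩
  subst hgd hbd
  have hg0' : 0 ≤ g := nonneg_of_mul_nonneg_right hg0 hypos
  have hU2 : U ≤ 3 * (a + g + b) := by
    refine le_of_mul_le_mul_left ?_ (mul_pos hypos hrpos); linarith
  have hgY : g ≤ v * h + y * g + r * a := by
    by_contra hlt; push Not at hlt
    have h1 := mul_lt_mul_of_pos_left hhY hv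
    have h2 := mul_lt_mul_of_pos_left haY hrpos
    have h3 := mul_lt_mul_of_pos_left hlt hypos
    have h4 : (v + y + r) * (v * h + y * g + r * a) = v * h + y * g + r * a := by
      rw [hsum, one_mul]
    linarith
  have hbdd : dd < b := by
    by_contra hle; push Not at hle; linarith
  have hMpos : 0 < M := by
    refine lt_of_le_of_ne hM fun hM0 => ?_
    rw [← hM0] at hddm hL
    have := mul_lt_mul_of_pos_left hbdd hypos
    linarith
  obtain ⟨l, hld⟩ : ∃ l, SL = M * (dm + l) := ⟨SL / M - dm, by field_simp; ring⟩
  obtain ⟨δ, hδd⟩ : ∃ δ, b = dm + l + δ := ⟨b - dm - l, by ring⟩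
  subst hld hδd
  have hl0 : 0 ≤ l := by
    have := le_of_mul_le_mul_left hL hMpos
    linarith
  have hddval : (M + y) * (dd - dm - l) = y * δ := by linarith
  have hδ0 : 0 ≤ δ := by
    have h1 : 0 ≤ (M + y) * (dm + l + δ - dd) := mul_nonneg hm.le (sub_nonneg.2 hbdd.le)
    refine nonneg_of_mul_nonneg_right (a := M) ?_ hMpos
    linarith
  have hrρ : r ≤ ρ := hρ ▸ le_mul_of_one_le_left hr (Real.one_le_exp (by linarith))
  have hkey : ρ * (U - dm) ≤ 3 * dc + 5 * dm + 5 * l + 3 * (y * δ) :=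
    center_distance_le hy hr hsum hrρ hρ1 hdm hhX haX hh0' ha0' hg0' hgY hl0 hδ0 hscore
      hU1 hU2 (by linarith)
  refine (hT ((1 - Real.exp (-M)) / M) (Real.exp (-M) * Real.exp v)
    (Real.exp (-M) * Real.exp v) ?_).trans ?_
  · intro W p q hW hWM hp hpy hq hqr
    exact split_coefficients hsum hMpos hW hWM hpy hqr
  have hval : dm * (1 - (1 - Real.exp (-M)) / M * M - Real.exp (-M) * Real.exp v * y
      - Real.exp (-M) * Real.exp v * r) + (1 - Real.exp (-M)) / M * (M * (dm + l))
      + Real.exp (-M) * Real.exp v * (y * (dm + l + δ)) + Real.exp (-M) * Real.exp v * (r * U)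
      = dm + l - Real.exp (-M) * l + P * (Real.exp (v + y) * y * (l + δ) + ρ * (U - dm)) := by
    rw [hEP, hρ]; field_simp; ring
  rw [hval]
  refine add_le_add le_rfl (mul_le_mul_of_nonneg_left ?_ he.le)
  have hEM : Real.exp (-M) = P * Real.exp y := by
    rw [hP, ← Real.exp_add]; congr 1; ring
  rw [hEM]
  have hσ : Real.exp (v + y) * y ≤ Real.exp y := by
    have h1 := exp_mul_one_sub_le_one v
    rw [Real.exp_add]
    have h2 : Real.exp v * y ≤ Real.exp v * (1 - v) := by gcongr; linarith
    calc Real.exp v * Real.exp y * y = Real.exp y * (Real.exp v * y) := by ring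
      _ ≤ Real.exp y * 1 := by gcongr; exact h2.trans h1
      _ = Real.exp y := mul_one _
  have hσ' : Real.exp (v + y) * y ≤ Real.exp 1 * y := by gcongr; linarith
  have hnum : (3 + Real.exp 1) * (y * δ) ≤ (Real.exp (M + y) + 5) * (dd - dm - l) := by
    have h1 := three_add_exp_one_mul_le (M + y) hm.le
    have h2 : 0 ≤ dd - dm - l := nonneg_of_mul_nonneg_right (hddval ▸ mul_nonneg hy hδ0) hm
    rw [← hddval, ← mul_assoc]
    gcongr
  have hPm : P * Real.exp (M + y) = 1 := by
    rw [hP, ← Real.exp_add]; simp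
  have hfin : -Real.exp y * l + Real.exp (v + y) * y * (l + δ) + ρ * (U - dm) ≤
      Real.exp (M + y) * (dd - dm - l) + (3 * dc + 5 * dd) := by
    have h1 := mul_le_mul_of_nonneg_right hσ hl0
    have h2 := mul_le_mul_of_nonneg_right hσ' hδ0
    linear_combination h1 + h2 + hnum + hkey
  have := mul_le_mul_of_nonneg_left hfin hPpos.le
  linear_combination this + (dd - dm - l) * hPm

/-! ### Distances -/

/-- The relaxed triangle inequality for a squared metric. -/
theorem Instance.IsSquaredMetric.le_three_mul {F : Type u} {C : Type v} {I : Instance F C}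
    (h : I.IsSquaredMetric) (i i' : F) (j j' : C) :
    I.c i j ≤ 3 * (I.c i j' + I.c i' j' + I.c i' j) := by
  have h1 := h i i' j j'
  have e1 := Real.sq_sqrt (I.c_nonneg i j)
  have e2 := Real.sq_sqrt (I.c_nonneg i j')
  have e3 := Real.sq_sqrt (I.c_nonneg i' j')
  have e4 := Real.sq_sqrt (I.c_nonneg i' j)
  have h2 : √(I.c i j) ^ 2 ≤ (√(I.c i j') + √(I.c i' j') + √(I.c i' j)) ^ 2 :=
    pow_le_pow_left₀ (Real.sqrt_nonneg _) h1 2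
  nlinarith [sq_nonneg (√(I.c i j') - √(I.c i' j')), sq_nonneg (√(I.c i j') - √(I.c i' j)),
    sq_nonneg (√(I.c i' j') - √(I.c i' j))]

/-- Averaging the relaxed triangle inequality over an intermediate point. -/
theorem sum_mul_sum_le_three_mul {K : Type w} (S T : Finset K) {a b f g h l : K → ℝ}
    (ha : ∀ k ∈ S, 0 ≤ a k) (hb : ∀ i ∈ T, 0 ≤ b i)
    (hf : ∀ k ∈ S, ∀ i ∈ T, f i ≤ 3 * (g i + h k + l k)) :
    (∑ k ∈ S, a k) * ∑ i ∈ T, b i * f i ≤ 3 * ((∑ k ∈ S, a k) * ∑ i ∈ T, b i * g i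
      + (∑ i ∈ T, b i) * ∑ k ∈ S, a k * h k + (∑ i ∈ T, b i) * ∑ k ∈ S, a k * l k) := by
  rw [mul_comm (∑ i ∈ T, b i), mul_comm (∑ i ∈ T, b i)]
  rw [Finset.sum_mul_sum, Finset.sum_mul_sum, Finset.sum_mul_sum, Finset.sum_mul_sum]
  simp only [← Finset.sum_add_distrib, Finset.mul_sum]
  refine Finset.sum_le_sum fun k hk => Finset.sum_le_sum fun i hi => ?_
  have := mul_le_mul_of_nonneg_left (hf k hk i hi) (mul_nonneg (ha k hk) (hb i hi))
  linarith

namespace CSRun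

variable {F : Type u} {C : Type v} [Fintype F] [Fintype C] {I : Instance F C} {γ : ℝ}
  {K : Type w} [Fintype K] (R : CSRun I γ K)

/-- The average distance `d^(c)` of a city to its close facilities. -/
abbrev avgClose (j : C) : ℝ :=
  avgDist (fun k j => I.c (R.orig k) j) R.ybar j (closeSet R.xbar j)

/-- The maximum distance `d^(max)` of a city to its close facilities. -/
abbrev maxClose (j : C) : ℝ := maxDist (fun k j => I.c (R.orig k) j) j (closeSet R.xbar j)

theorem avgClose_eq (j : C) :
    R.avgClose j = ∑ k ∈ closeSet R.xbar j, R.ybar k * I.c (R.orig k) j := by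
  rw [avgClose, avgDist, R.sum_ybar_closeSet, div_one]
  exact Finset.sum_congr rfl fun _ _ => mul_comm _ _

theorem le_maxClose {k : K} {j : C} (hk : k ∈ closeSet R.xbar j) :
    I.c (R.orig k) j ≤ R.maxClose j :=
  le_csSup ((Set.toFinite _).bddAbove) ⟨k, hk, rfl⟩

theorem exists_eq_maxClose (j : C) :
    ∃ k ∈ closeSet R.xbar j, I.c (R.orig k) j = R.maxClose j := by
  obtain ⟨k, hk, h⟩ := Set.Nonempty.csSup_mem
    (((R.closeSet_nonempty j).to_set).image fun k => I.c (R.orig k) j) (Set.toFinite _)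
  exact ⟨k, hk, h⟩

theorem maxClose_nonneg (j : C) : 0 ≤ R.maxClose j := by
  obtain ⟨k, -, hk⟩ := R.exists_eq_maxClose j
  exact hk ▸ I.c_nonneg _ _

theorem avgClose_nonneg (j : C) : 0 ≤ R.avgClose j := by
  rw [avgClose_eq]
  exact Finset.sum_nonneg fun k _ => mul_nonneg (R.ybar_nonneg k) (I.c_nonneg _ _)

theorem avgClose_le_maxClose (j : C) : R.avgClose j ≤ R.maxClose j := by
  rw [avgClose_eq]
  calc _ ≤ ∑ k ∈ closeSet R.xbar j, R.ybar k * R.maxClose j :=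
        Finset.sum_le_sum fun k hk => mul_le_mul_of_nonneg_left (R.le_maxClose hk) (R.ybar_nonneg k)
    _ = _ := by rw [← Finset.sum_mul, R.sum_ybar_closeSet, one_mul]

/-- Facilities that are not close are at least as far away as all the close ones, unless their
fractional opening is zero. -/
theorem maxClose_le {k : K} {j : C} (hk : k ∉ closeSet R.xbar j) (hy : R.ybar k ≠ 0) :
    R.maxClose j ≤ I.c (R.orig k) j := by
  by_contra! hlt
  obtain ⟨k₀, hk₀, h⟩ := R.exists_eq_maxClose j
  rw [← h] at hlt
  have := R.closest k₀ k j (R.mem_closeSet.1 hk₀) hlt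
  exact hk (R.mem_closeSet.2 (this ▸ lt_of_le_of_ne (R.ybar_nonneg k) hy.symm))

/-! ### Close and distant parts of the fractional solution -/

/-- The scaled optimal assignment of a city can be changed, without increasing its cost, so that it
uses the close facilities up to their full fractional opening. -/
theorem exists_weights (hγ : 1 ≤ γ) (j : C) : ∃ z : K → ℝ, (∀ k, 0 ≤ z k) ∧
    (∀ k, z k ≤ R.ybar k) ∧ (∀ k ∈ closeSet R.xbar j, z k = R.ybar k) ∧ ∑ k, z k = γ ∧
    ∑ k, z k * I.c (R.orig k) j ≤ γ * ∑ i, R.xs i j * I.c i j := by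
  have hfeas := R.optimal.1
  set z₀ : K → ℝ := fun k => R.ybar k * (R.xs (R.orig k) j / R.ys (R.orig k)) with hz₀
  have hz₀0 : ∀ k, 0 ≤ z₀ k := fun k =>
    mul_nonneg (R.ybar_nonneg k) (div_nonneg (hfeas.x_nonneg _ _) (hfeas.y_nonneg _))
  have hz₀le : ∀ k, z₀ k ≤ R.ybar k := fun k =>
    mul_le_of_le_one_right (R.ybar_nonneg k) (div_le_one_of_le₀ (hfeas.le _ _) (hfeas.y_nonneg _))
  have hsum : ∀ w : F → ℝ, ∑ k, z₀ k * w (R.orig k) = γ * ∑ i, R.xs i j * w i := by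
    intro w
    rw [← Finset.sum_fiberwise Finset.univ R.orig, Finset.mul_sum]
    refine Finset.sum_congr rfl fun i _ => ?_
    have : ∀ k ∈ Finset.univ.filter (fun k => R.orig k = i),
        z₀ k * w (R.orig k) = R.ybar k * (R.xs i j / R.ys i * w i) := by
      intro k hk
      have hki : R.orig k = i := (Finset.mem_filter.1 hk).2
      simp only [hz₀, hki]; ring
    rw [Finset.sum_congr rfl this, ← Finset.sum_mul, R.ybar_sum i]
    by_cases hy : R.ys i = 0
    · have : R.xs i j = 0 := le_antisymm (hy ▸ hfeas.le i j) (hfeas.x_nonneg i j)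
      simp [hy, this]
    · field_simp
  have hsum1 : ∑ k, z₀ k = γ := by
    have := hsum fun _ => 1
    simpa [hfeas.sum_eq_one j] using this
  set A := closeSet R.xbar j with hA
  set a := ∑ k ∈ A, z₀ k with ha
  have hsplit : ∀ f : K → ℝ, ∑ k, f k = ∑ k ∈ A, f k + ∑ k ∈ Aᶜ, f k := fun f =>
    (Finset.sum_add_sum_compl A f).symm
  have ha1 : a ≤ 1 := by
    rw [← R.sum_ybar_closeSet j]
    exact Finset.sum_le_sum fun k _ => hz₀le k
  set D := ∑ k ∈ Aᶜ, z₀ k with hD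
  have haD : a + D = γ := by rw [← hsum1, hsplit]
  have hD0 : 0 ≤ D := Finset.sum_nonneg fun k _ => hz₀0 k
  set t := (γ - 1) / D with ht
  have htD : t * D = γ - 1 := by
    by_cases h : D = 0
    · rw [h]; linarith
    · rw [ht]; field_simp
  have ht0 : 0 ≤ t := div_nonneg (by linarith) hD0
  have ht1 : t ≤ 1 := div_le_one_of_le₀ (by linarith) hD0
  have hpart : ∀ f : K → ℝ, ∑ k, (if k ∈ A then R.ybar k else t * z₀ k) * f k
      = ∑ k ∈ A, R.ybar k * f k + t * ∑ k ∈ Aᶜ, z₀ k * f k := by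
    intro f
    rw [hsplit, Finset.mul_sum]
    congr 1
    · exact Finset.sum_congr rfl fun k hk => by rw [if_pos hk]
    · exact Finset.sum_congr rfl fun k hk => by
        rw [if_neg (Finset.mem_compl.1 hk), mul_assoc]
  refine ⟨fun k => if k ∈ A then R.ybar k else t * z₀ k, fun k => ?_, fun k => ?_,
    fun k hk => if_pos hk, ?_, ?_⟩
  · dsimp only
    split_ifs
    exacts [R.ybar_nonneg k, mul_nonneg ht0 (hz₀0 k)]
  · dsimp only
    split_ifs
    exacts [le_rfl, (mul_le_of_le_one_left (hz₀0 k) ht1).trans (hz₀le k)]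
  · have := hpart fun _ => 1
    simp only [mul_one] at this
    rw [this, R.sum_ybar_closeSet j, htD]; ring
  · rw [hpart fun k => I.c (R.orig k) j, ← hsum fun i => I.c i j, hsplit]
    have h1 : ∑ k ∈ A, R.ybar k * I.c (R.orig k) j - ∑ k ∈ A, z₀ k * I.c (R.orig k) j ≤
        (1 - a) * R.maxClose j := by
      rw [← R.sum_ybar_closeSet j, ha, ← Finset.sum_sub_distrib, ← Finset.sum_sub_distrib,
        Finset.sum_mul]
      refine Finset.sum_le_sum fun k hk => ?_
      rw [← sub_mul]
      exact mul_le_mul_of_nonneg_left (R.le_maxClose hk) (sub_nonneg.2 (hz₀le k))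
    have h2 : D * R.maxClose j ≤ ∑ k ∈ Aᶜ, z₀ k * I.c (R.orig k) j := by
      rw [hD, Finset.sum_mul]
      refine Finset.sum_le_sum fun k hk => ?_
      by_cases hy : R.ybar k = 0
      · simp [hz₀, hy]
      · exact mul_le_mul_of_nonneg_left (R.maxClose_le (Finset.mem_compl.1 hk) hy) (hz₀0 k)
    have h3 := mul_le_mul_of_nonneg_left h2 (sub_nonneg.2 ht1)
    have h4 : (1 - t) * (D * R.maxClose j) = (1 - a) * R.maxClose j := by
      rw [← mul_assoc, sub_mul, htD, one_mul, show D - (γ - 1) = 1 - a by linarith]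
    linarith

/-- The layer cake estimate of the expected connection cost of `j`, with respect to a cluster center
`j'` and to weights `z`, for all admissible coefficients. -/
theorem expectation_connectionCost_le {j j' : C} (hj' : j' ∈ R.centers) {z : K → ℝ}
    (hz0 : ∀ k, 0 ≤ z k) (hz : ∀ k, z k ≤ R.ybar k) {v y r M A₂ A₃ A₄ : ℝ}
    (hv : v = ∑ k ∈ closeSet R.xbar j ∩ closeSet R.xbar j', R.ybar k)
    (hy : y = ∑ k ∈ closeSet R.xbar j' \ closeSet R.xbar j, z k)
    (hr : r = ∑ k ∈ closeSet R.xbar j' \ closeSet R.xbar j, (R.ybar k - z k))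
    (hM : M = ∑ k ∈ (closeSet R.xbar j ∪ closeSet R.xbar j')ᶜ, z k)
    (hcoef : ∀ W p q, 0 ≤ W → W ≤ M → 0 ≤ p → p ≤ y → 0 ≤ q → q ≤ r →
      Real.exp v * Real.exp (-W) * (p + q) ≤ A₂ * (M - W) + A₃ * p + A₄ * q) :
    R.expectation (fun ω => R.connectionCost ω j) ≤
      (1 - Real.exp (-1)) * R.avgClose j + Real.exp (-1) *
        (R.maxClose j * (1 - A₂ * M - A₃ * y - A₄ * r)
          + A₂ * ∑ k ∈ (closeSet R.xbar j ∪ closeSet R.xbar j')ᶜ, z k * I.c (R.orig k) j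
          + A₃ * ∑ k ∈ closeSet R.xbar j' \ closeSet R.xbar j, z k * I.c (R.orig k) j
          + A₄ * ∑ k ∈ closeSet R.xbar j' \ closeSet R.xbar j,
              (R.ybar k - z k) * I.c (R.orig k) j) := by
  set A := closeSet R.xbar j with hA
  set B := closeSet R.xbar j' with hB
  have hsplit : ∀ f : K → ℝ,
      ∑ k, f k = ∑ k ∈ A, f k + ∑ k ∈ B \ A, f k + ∑ k ∈ (A ∪ B)ᶜ, f k := by
    intro f
    rw [← Finset.sum_add_sum_compl (A ∪ B) f, ← Finset.union_sdiff_self_eq_union,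
      Finset.sum_union Finset.disjoint_sdiff]
  set e := Real.exp (-1) with he
  have he0 : 0 < e := Real.exp_pos _
  -- the coefficient of the distance to the copy `k`
  set κ : K → ℝ := fun k => if k ∈ A then (1 - e) * R.ybar k
    else if k ∈ B then e * (A₃ * z k + A₄ * (R.ybar k - z k)) else e * (A₂ * z k) with hκ
  have hκsum : ∀ f : K → ℝ, ∑ k, κ k * f k = (1 - e) * ∑ k ∈ A, R.ybar k * f k
      + e * (A₂ * ∑ k ∈ (A ∪ B)ᶜ, z k * f k + A₃ * ∑ k ∈ B \ A, z k * f k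
        + A₄ * ∑ k ∈ B \ A, (R.ybar k - z k) * f k) := by
    intro f
    have h1 : ∑ k ∈ A, κ k * f k = (1 - e) * ∑ k ∈ A, R.ybar k * f k := by
      rw [Finset.mul_sum]
      exact Finset.sum_congr rfl fun k hk => by simp only [hκ, if_pos hk]; ring
    have h2 : ∑ k ∈ B \ A, κ k * f k = e * (A₃ * ∑ k ∈ B \ A, z k * f k
        + A₄ * ∑ k ∈ B \ A, (R.ybar k - z k) * f k) := by
      simp only [Finset.mul_sum, ← Finset.sum_add_distrib]
      refine Finset.sum_congr rfl fun k hk => ?_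
      simp only [hκ, if_neg (Finset.mem_sdiff.1 hk).2, if_pos (Finset.mem_sdiff.1 hk).1]; ring
    have h3 : ∑ k ∈ (A ∪ B)ᶜ, κ k * f k = e * (A₂ * ∑ k ∈ (A ∪ B)ᶜ, z k * f k) := by
      simp only [Finset.mul_sum]
      refine Finset.sum_congr rfl fun k hk => ?_
      have hk' : k ∉ A ∧ k ∉ B := by simpa using hk
      simp only [hκ, if_neg hk'.1, if_neg hk'.2]; ring
    rw [hsplit, h1, h2, h3]; ring
  set c : K → ℝ := fun k => I.c (R.orig k) j with hc
  set dm := R.maxClose j with hdm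
  have hmain : ∑ ω, R.prob ω * R.connectionCost ω j ≤ ∑ k, κ k * c k +
      e * (1 - A₂ * M - A₃ * y - A₄ * r) * dm := by
    refine sum_mul_le_of_layers _ _ _ _ _ _ (fun ω => R.connectionCost_nonneg ω j)
      (fun k => I.c_nonneg _ _) (R.maxClose_nonneg j) ?_
    intro τ hτ
    set S := Finset.univ.filter fun k => c k ≤ τ with hS
    set χ : K → ℝ := fun k => if τ < c k then 1 else 0 with hχ
    have hχS : ∀ k, k ∈ S → χ k = 0 := fun k hk =>
      if_neg (not_lt.2 (Finset.mem_filter.1 hk).2)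
    have hχS' : ∀ k, k ∉ S → χ k = 1 := fun k hk =>
      if_pos (not_le.1 fun h => hk (Finset.mem_filter.2 ⟨Finset.mem_univ _, h⟩))
    have hχ0 : ∀ k, 0 ≤ χ k := fun k => by simp only [hχ]; split_ifs <;> norm_num
    have hχ1 : ∀ k, χ k ≤ 1 := fun k => by simp only [hχ]; split_ifs <;> norm_num
    have hsumS : ∀ (T : Finset K) (f : K → ℝ),
        ∑ k ∈ T, f k * χ k = ∑ k ∈ T, f k - ∑ k ∈ S ∩ T, f k := by
      intro T f
      rw [Finset.inter_comm, ← Finset.filter_mem_eq_inter, Finset.sum_filter,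
        ← Finset.sum_sub_distrib]
      refine Finset.sum_congr rfl fun k _ => ?_
      by_cases hk : k ∈ S
      · simp [hk, hχS k hk]
      · simp [hk, hχS' k hk]
    have hprob : ∑ ω, R.prob ω * (if τ < R.connectionCost ω j then 1 else 0)
        = R.probClosed S := by
      refine Finset.sum_congr rfl fun ω _ => ?_
      simp only [R.lt_connectionCost_iff ω j τ]
      rfl
    rw [hprob, hκsum χ]
    have hbound := R.probClosed_le hj' S
    by_cases hτdm : τ < dm
    · -- below the maximum close distance, only close facilities matter
      rw [if_pos hτdm, mul_one]
      have hfar : ∀ k, k ∉ A → z k * χ k = z k ∧ (R.ybar k - z k) * χ k = R.ybar k - z k := by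
        intro k hk
        by_cases hy0 : R.ybar k = 0
        · have : z k = 0 := le_antisymm (hy0 ▸ hz k) (hz0 k)
          simp [hy0, this]
        · have : χ k = 1 := if_pos (hτdm.trans_le (R.maxClose_le hk hy0))
          simp [this]
      have e1 : ∑ k ∈ (A ∪ B)ᶜ, z k * χ k = M := by
        rw [hM]
        refine Finset.sum_congr rfl fun k hk => (hfar k ?_).1
        have hk' : k ∉ A ∧ k ∉ B := by simpa using hk
        exact hk'.1
      have e2 : ∑ k ∈ B \ A, z k * χ k = y := by
        rw [hy]
        exact Finset.sum_congr rfl fun k hk => (hfar k (Finset.mem_sdiff.1 hk).2).1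
      have e3 : ∑ k ∈ B \ A, (R.ybar k - z k) * χ k = r := by
        rw [hr]
        exact Finset.sum_congr rfl fun k hk => (hfar k (Finset.mem_sdiff.1 hk).2).2
      rw [e1, e2, e3, hsumS A R.ybar, R.sum_ybar_closeSet j]
      set W := ∑ k ∈ S ∩ A, R.ybar k with hW
      have hW0 : 0 ≤ W := Finset.sum_nonneg fun k _ => R.ybar_nonneg k
      have hW1 : W ≤ 1 := by
        rw [← R.sum_ybar_closeSet j]
        exact Finset.sum_le_sum_of_subset_of_nonneg Finset.inter_subset_right
          fun k _ _ => R.ybar_nonneg k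
      have h1 : R.probClosed S ≤ Real.exp (-W) := by
        refine hbound.trans ((mul_le_mul_of_nonneg_right (Real.one_sub_le_exp_neg _)
          (Real.exp_pos _).le).trans ?_)
        rw [← Real.exp_add, Real.exp_le_exp, ← neg_add, neg_le_neg_iff,
          Finset.sum_inter_add_sum_sdiff]
        exact Finset.sum_le_sum_of_subset_of_nonneg Finset.inter_subset_left
          fun k _ _ => R.ybar_nonneg k
      have h2 := exp_neg_chord hW0 hW1
      linarith
    · -- beyond it, all close facilities count
      have hAS : A ⊆ S := fun k hk =>
        Finset.mem_filter.2 ⟨Finset.mem_univ _, (R.le_maxClose hk).trans (not_lt.1 hτdm)⟩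
      rw [if_neg hτdm, mul_zero, add_zero]
      have e1 : ∑ k ∈ A, R.ybar k * χ k = 0 :=
        Finset.sum_eq_zero fun k hk => by rw [hχS k (hAS hk), mul_zero]
      rw [e1, mul_zero, zero_add]
      set p := ∑ k ∈ B \ A, z k * χ k with hp
      set q := ∑ k ∈ B \ A, (R.ybar k - z k) * χ k with hq
      set W := ∑ k ∈ S ∩ (A ∪ B)ᶜ, z k with hW
      have hMW : ∑ k ∈ (A ∪ B)ᶜ, z k * χ k = M - W := by rw [hsumS, hM]
      have hW0 : 0 ≤ W := Finset.sum_nonneg fun k _ => hz0 k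
      have hWM : W ≤ M := by
        rw [hM]
        exact Finset.sum_le_sum_of_subset_of_nonneg Finset.inter_subset_right fun k _ _ => hz0 k
      have hp0 : 0 ≤ p := Finset.sum_nonneg fun k _ => mul_nonneg (hz0 k) (hχ0 k)
      have hpy : p ≤ y := by
        rw [hy]
        exact Finset.sum_le_sum fun k _ => mul_le_of_le_one_right (hz0 k) (hχ1 k)
      have hq0 : 0 ≤ q :=
        Finset.sum_nonneg fun k _ => mul_nonneg (sub_nonneg.2 (hz k)) (hχ0 k)
      have hqr : q ≤ r := by
        rw [hr]
        exact Finset.sum_le_sum fun k _ =>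
          mul_le_of_le_one_right (sub_nonneg.2 (hz k)) (hχ1 k)
      have hpq : 1 - ∑ k ∈ S ∩ B, R.ybar k = p + q := by
        rw [← R.sum_ybar_closeSet j', ← hsumS B R.ybar, hp, hq, ← Finset.sum_add_distrib,
          ← Finset.sum_inter_add_sum_sdiff B A]
        have : ∑ k ∈ B ∩ A, R.ybar k * χ k = 0 :=
          Finset.sum_eq_zero fun k hk => by
            rw [hχS k (hAS (Finset.mem_inter.1 hk).2), mul_zero]
        rw [this, zero_add]
        exact Finset.sum_congr rfl fun k _ => by ring
      have hrest : 1 - v + W ≤ ∑ k ∈ S \ B, R.ybar k := by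
        have h1 : 1 - v = ∑ k ∈ A \ B, R.ybar k := by
          rw [hv, ← R.sum_ybar_closeSet j, ← hA, ← Finset.sum_inter_add_sum_sdiff A B]; ring
        have h2 : W ≤ ∑ k ∈ S ∩ (A ∪ B)ᶜ, R.ybar k := Finset.sum_le_sum fun k _ => hz k
        have h3 : Disjoint (A \ B) (S ∩ (A ∪ B)ᶜ) := by
          rw [Finset.disjoint_left]
          intro k hk hk'
          simp only [Finset.mem_inter, Finset.mem_compl, Finset.mem_union, not_or] at hk'
          exact hk'.2.1 (Finset.mem_sdiff.1 hk).1
        rw [h1]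
        refine (add_le_add le_rfl h2).trans ?_
        rw [← Finset.sum_union h3]
        refine Finset.sum_le_sum_of_subset_of_nonneg (fun k hk => ?_) fun k _ _ => R.ybar_nonneg k
        rcases Finset.mem_union.1 hk with hk | hk
        · exact Finset.mem_sdiff.2 ⟨hAS (Finset.mem_sdiff.1 hk).1, (Finset.mem_sdiff.1 hk).2⟩
        · simp only [Finset.mem_inter, Finset.mem_compl, Finset.mem_union, not_or] at hk
          exact Finset.mem_sdiff.2 ⟨hk.1, hk.2.2⟩
      have h1 : R.probClosed S ≤ (p + q) * Real.exp (-(1 - v + W)) := by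
        rw [hpq] at hbound
        refine hbound.trans (mul_le_mul_of_nonneg_left ?_ (add_nonneg hp0 hq0))
        exact Real.exp_le_exp.2 (neg_le_neg hrest)
      have h2 : Real.exp (-(1 - v + W)) = e * (Real.exp v * Real.exp (-W)) := by
        rw [he, ← Real.exp_add, ← Real.exp_add]; congr 1; ring
      have h3 := mul_le_mul_of_nonneg_left (hcoef W p q hW0 hWM hp0 hpy hq0 hqr) he0.le
      rw [hMW]
      rw [h2] at h1
      linarith
  rw [R.expectation_eq_sum]
  rw [hκsum c] at hmain
  rw [R.avgClose_eq]
  linarith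

end CSRun

namespace CSRun

variable {F : Type u} {C : Type v} [Fintype F] [Fintype C] {I : Instance F C} {γ : ℝ}
  {K : Type w} [Fintype K] (R : CSRun I γ K)

/-! ### The expected connection cost -/

/-- The bound on the expected connection cost in terms of the distances to the close and to the
distant facilities, and the relation of these distances to the fractional connection cost. -/
theorem exists_distant_bound (hI : I.IsSquaredMetric) (hγ : 1 < γ) (j : C) : ∃ dd : ℝ,
    R.avgClose j ≤ dd ∧
    R.avgClose j + (γ - 1) * dd ≤ γ * ∑ i, R.xs i j * I.c i j ∧
    R.expectation (fun ω => R.connectionCost ω j) ≤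
      (1 - Real.exp (-1) + 3 * Real.exp (-γ)) * R.avgClose j
        + (Real.exp (-1) + 5 * Real.exp (-γ)) * dd := by
  obtain ⟨j', hj', hscore, k₀, hk₀', hk₀⟩ := R.exists_center j
  obtain ⟨z, hz0, hz, hzA, hzsum, hzcost⟩ := R.exists_weights hγ.le j
  change R.avgClose j' + R.maxClose j' ≤ R.avgClose j + R.maxClose j at hscore
  set A := closeSet R.xbar j with hA
  set B := closeSet R.xbar j' with hB
  have hsplit : ∀ f : K → ℝ,
      ∑ k, f k = ∑ k ∈ A, f k + ∑ k ∈ B \ A, f k + ∑ k ∈ (A ∪ B)ᶜ, f k := by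
    intro f
    rw [← Finset.sum_add_sum_compl (A ∪ B) f, ← Finset.union_sdiff_self_eq_union,
      Finset.sum_union Finset.disjoint_sdiff]
  have hsplitB : ∀ f : K → ℝ, ∑ k ∈ B, R.ybar k * f k = ∑ k ∈ A ∩ B, R.ybar k * f k
      + ∑ k ∈ B \ A, z k * f k + ∑ k ∈ B \ A, (R.ybar k - z k) * f k := by
    intro f
    rw [← Finset.sum_inter_add_sum_sdiff B A, Finset.inter_comm, add_assoc,
      ← Finset.sum_add_distrib]
    exact congrArg _ (Finset.sum_congr rfl fun k _ => by ring)
  have hfar : ∀ k, k ∉ A → z k * R.maxClose j ≤ z k * I.c (R.orig k) j := by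
    intro k hk
    by_cases hy : R.ybar k = 0
    · rw [le_antisymm (hy ▸ hz k) (hz0 k), zero_mul, zero_mul]
    · exact mul_le_mul_of_nonneg_left (R.maxClose_le hk hy) (hz0 k)
  have hyz : ∀ k, 0 ≤ R.ybar k - z k := fun k => sub_nonneg.2 (hz k)
  obtain ⟨v, hv⟩ : ∃ v, v = ∑ k ∈ A ∩ B, R.ybar k := ⟨_, rfl⟩
  obtain ⟨y, hy⟩ : ∃ y, y = ∑ k ∈ B \ A, z k := ⟨_, rfl⟩
  obtain ⟨r, hr⟩ : ∃ r, r = ∑ k ∈ B \ A, (R.ybar k - z k) := ⟨_, rfl⟩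
  obtain ⟨M, hM⟩ : ∃ M, M = ∑ k ∈ (A ∪ B)ᶜ, z k := ⟨_, rfl⟩
  have hsum : v + y + r = 1 := by
    have := hsplitB fun _ => 1
    simp only [mul_one] at this
    rw [hv, hy, hr, ← this, R.sum_ybar_closeSet]
  have hMy : M + y = γ - 1 := by
    have := hsplit z
    rw [hzsum, Finset.sum_congr rfl hzA, R.sum_ybar_closeSet, ← hy, ← hM] at this
    linarith
  have hL : M * R.maxClose j ≤ ∑ k ∈ (A ∪ B)ᶜ, z k * I.c (R.orig k) j := by
    rw [hM, Finset.sum_mul]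
    refine Finset.sum_le_sum fun k hk => hfar k ?_
    have hk' : k ∉ A ∧ k ∉ B := by simpa using hk
    exact hk'.1
  have hb : y * R.maxClose j ≤ ∑ k ∈ B \ A, z k * I.c (R.orig k) j := by
    rw [hy, Finset.sum_mul]
    exact Finset.sum_le_sum fun k hk => hfar k (Finset.mem_sdiff.1 hk).2
  have hB_le : ∀ k ∈ B, I.c (R.orig k) j' ≤ R.maxClose j' := fun k hk => R.le_maxClose hk
  have hAB : ∀ k ∈ A ∩ B, k ∈ A ∧ k ∈ B := fun k => Finset.mem_inter.1
  have hBA : ∀ k ∈ B \ A, k ∈ B ∧ k ∉ A := fun k => Finset.mem_sdiff.1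
  have hv0 : 0 < v := by
    rw [hv]
    exact Finset.sum_pos (fun k hk => R.ybar_pos (hAB k hk).1)
      ⟨k₀, Finset.mem_inter.2 ⟨hk₀, hk₀'⟩⟩
  have hU : v * ∑ k ∈ B \ A, (R.ybar k - z k) * I.c (R.orig k) j ≤
      3 * (v * ∑ k ∈ B \ A, (R.ybar k - z k) * I.c (R.orig k) j'
        + r * ∑ k ∈ A ∩ B, R.ybar k * I.c (R.orig k) j' + r * v * R.maxClose j) := by
    have h := sum_mul_sum_le_three_mul (A ∩ B) (B \ A) (a := R.ybar)
      (b := fun k => R.ybar k - z k) (f := fun k => I.c (R.orig k) j)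
      (g := fun k => I.c (R.orig k) j') (h := fun k => I.c (R.orig k) j')
      (l := fun _ => R.maxClose j) (fun k _ => R.ybar_nonneg k) (fun k _ => hyz k)
      (fun k hk i _ => (hI.le_three_mul (R.orig i) (R.orig k) j j').trans (by
        have := R.le_maxClose (hAB k hk).1
        linarith))
    rw [← Finset.sum_mul, ← hv, ← hr] at h
    linarith
  have hU' : y * ∑ k ∈ B \ A, (R.ybar k - z k) * I.c (R.orig k) j ≤
      3 * (y * ∑ k ∈ B \ A, (R.ybar k - z k) * I.c (R.orig k) j'
        + r * ∑ k ∈ B \ A, z k * I.c (R.orig k) j'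
        + r * ∑ k ∈ B \ A, z k * I.c (R.orig k) j) := by
    rw [hy, hr]
    exact sum_mul_sum_le_three_mul (B \ A) (B \ A) (fun k _ => hz0 k) (fun k _ => hyz k)
      (fun k _ i _ => hI.le_three_mul (R.orig i) (R.orig k) j j')
  have hscore' : ∑ k ∈ A ∩ B, R.ybar k * I.c (R.orig k) j'
      + ∑ k ∈ B \ A, z k * I.c (R.orig k) j'
      + ∑ k ∈ B \ A, (R.ybar k - z k) * I.c (R.orig k) j' + R.maxClose j' ≤
      R.avgClose j + R.maxClose j := by
    rw [← hsplitB, ← R.avgClose_eq]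
    exact hscore
  have hm : M + y ≠ 0 := by rw [hMy]; linarith
  have hdd : (γ - 1) * ((∑ k ∈ (A ∪ B)ᶜ, z k * I.c (R.orig k) j
      + ∑ k ∈ B \ A, z k * I.c (R.orig k) j) / (M + y)) =
      ∑ k ∈ (A ∪ B)ᶜ, z k * I.c (R.orig k) j + ∑ k ∈ B \ A, z k * I.c (R.orig k) j := by
    rw [← hMy]
    field_simp
  have hcost := cost_le_of_coefficients (dc := R.avgClose j) hv0
    (hy ▸ Finset.sum_nonneg fun k _ => hz0 k) (hr ▸ Finset.sum_nonneg fun k _ => hyz k)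
    (hM ▸ Finset.sum_nonneg fun k _ => hz0 k) hsum (by rw [hMy]; linarith)
    (R.avgClose_nonneg j) (R.maxClose_nonneg j) hL hb
    (Finset.sum_nonneg fun k _ => mul_nonneg (R.ybar_nonneg k) (I.c_nonneg _ _))
    (Finset.sum_nonneg fun k _ => mul_nonneg (hyz k) (I.c_nonneg _ _))
    (Finset.sum_nonneg fun k _ => mul_nonneg (hz0 k) (I.c_nonneg _ _))
    (by
      rw [hv, Finset.sum_mul]
      exact Finset.sum_le_sum fun k hk =>
        mul_le_mul_of_nonneg_left (hB_le k (hAB k hk).2) (R.ybar_nonneg k))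
    (by
      rw [hy, Finset.sum_mul]
      exact Finset.sum_le_sum fun k hk =>
        mul_le_mul_of_nonneg_left (hB_le k (hBA k hk).1) (hz0 k))
    (by
      rw [hr, Finset.sum_mul]
      exact Finset.sum_le_sum fun k hk =>
        mul_le_mul_of_nonneg_left (hB_le k (hBA k hk).1) (hyz k))
    hscore' hU hU'
    (fun A₂ A₃ A₄ hcoef => R.expectation_connectionCost_le hj' hz0 hz hv hy hr hM hcoef)
  rw [show M + y + 1 = γ by linarith] at hcost
  refine ⟨_, ?_, ?_, hcost⟩
  · refine (R.avgClose_le_maxClose j).trans ?_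
    refine le_of_mul_le_mul_left ?_ (sub_pos.2 hγ)
    rw [hdd, ← hMy]
    linarith
  · rw [hdd]
    refine le_trans (le_of_eq ?_) hzcost
    rw [hsplit, R.avgClose_eq, Finset.sum_congr rfl fun k hk => by rw [← hzA k hk]]
    ring

/-- Without scaling the distant facilities vanish, so that a city with fractional connection cost
zero is at distance zero from its close facilities and from those of its cluster center. -/
theorem connectionCost_eq_zero (hI : I.IsSquaredMetric) (hγ : γ = 1) {j : C}
    (h0 : ∑ i, R.xs i j * I.c i j = 0) (ω : R.Outcome) : R.connectionCost ω j = 0 := by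
  obtain ⟨j', hj', hscore, k, hk', hk⟩ := R.exists_center j
  obtain ⟨z, hz0, hz, hzA, -, hzcost⟩ := R.exists_weights hγ.ge j
  change R.avgClose j' + R.maxClose j' ≤ R.avgClose j + R.maxClose j at hscore
  rw [h0, mul_zero] at hzcost
  have hzero : ∀ l ∈ closeSet R.xbar j, I.c (R.orig l) j ≤ 0 := by
    intro l hl
    have h1 := (Finset.single_le_sum (f := fun k => z k * I.c (R.orig k) j)
      (fun k _ => mul_nonneg (hz0 k) (I.c_nonneg _ _)) (Finset.mem_univ l)).trans hzcost
    rw [hzA l hl] at h1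
    exact nonpos_of_mul_nonpos_right h1 (R.ybar_pos hl)
  have hmax : R.maxClose j ≤ 0 := by
    obtain ⟨l, hl, h⟩ := R.exists_eq_maxClose j
    exact h ▸ hzero l hl
  have havg := R.avgClose_le_maxClose j
  have havg' := R.avgClose_nonneg j'
  set s := ω.1 ⟨j', hj'⟩ with hs
  have h1 := R.connectionCost_le (R.mem_openCopies_center ω ⟨j', hj'⟩) j
  have h2 := hI.le_three_mul (R.orig s.1) (R.orig k) j j'
  have h3 : I.c (R.orig s.1) j' ≤ R.maxClose j' := R.le_maxClose s.2
  have h4 := R.le_maxClose hk'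
  have h5 := hzero k hk
  exact le_antisymm (h1.trans (by linarith)) (R.connectionCost_nonneg ω j)

/-- The bound for `γ > 1`: a linear fractional function of the distances to the close and the
distant facilities is largest when the two are equal or the former is zero. -/
theorem expectation_connectionCost_le_max (hI : I.IsSquaredMetric) (hγ : 1 < γ) (j : C) :
    R.expectation (fun ω => R.connectionCost ω j) ≤
      max (1 + 8 * Real.exp (-γ)) ((5 * Real.exp (-γ) + Real.exp (-1)) / (1 - 1 / γ))
        * ∑ i, R.xs i j * I.c i j := by
  obtain ⟨dd, h1, h2, h3⟩ := R.exists_distant_bound hI hγ j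
  set ρ := max (1 + 8 * Real.exp (-γ)) ((5 * Real.exp (-γ) + Real.exp (-1)) / (1 - 1 / γ)) with hρ
  have hγ0 : 0 < γ := by linarith
  have hγ1 : 0 < 1 - 1 / γ := by
    rw [sub_pos, div_lt_one hγ0]; exact hγ
  have hρ1 : 1 + 8 * Real.exp (-γ) ≤ ρ := le_max_left _ _
  have hρ2 : 5 * Real.exp (-γ) + Real.exp (-1) ≤ ρ * (1 - 1 / γ) :=
    (div_le_iff₀ hγ1).1 (le_max_right _ _)
  have hρ0 : 0 ≤ ρ := le_trans (by positivity) hρ1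
  have h4 := mul_le_mul_of_nonneg_right hρ1 (R.avgClose_nonneg j)
  have h5 := mul_le_mul_of_nonneg_right hρ2 (sub_nonneg.2 h1)
  have h6 : 1 / γ * (R.avgClose j + (γ - 1) * dd) ≤ ∑ i, R.xs i j * I.c i j := by
    rw [one_div, inv_mul_le_iff₀ hγ0]; exact h2
  have h7 : 1 / γ * (R.avgClose j + (γ - 1) * dd)
      = R.avgClose j + (1 - 1 / γ) * (dd - R.avgClose j) := by
    field_simp; ring
  have h8 := mul_le_mul_of_nonneg_left (h7 ▸ h6) hρ0
  linarith

end CSRun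

end FacilityLocation

end

theorem mainTheorem3 {F : Type*} {C : Type*} [Fintype F] [Nonempty F] [Fintype C]
    (I : FacilityLocation.Instance F C) (hI : I.IsSquaredMetric) (γ : ℝ) (hγ : 1 ≤ γ) :
    (∃ n : ℕ, Nonempty (FacilityLocation.CSRun I γ (Fin n))) ∧
    ∀ (K : Type*) [Fintype K] (R : FacilityLocation.CSRun I γ K),
      (∀ ω : R.Outcome, ∃ x : F → C → ℝ, (∀ i j, x i j = 0 ∨ x i j = 1) ∧
        I.LPFeasible x (R.openVar ω) ∧ ∀ j, ∑ i, x i j * I.c i j = R.connectionCost ω j) ∧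
      (∀ i, R.expectation (fun ω => R.facilityCost ω i) = γ * (R.ys i * I.f i)) ∧
      (∀ i, R.expectation (fun ω => R.openVar ω i * I.f i) ≤ γ * (R.ys i * I.f i)) ∧
      ∀ j, ENNReal.ofReal (R.expectation (fun ω => R.connectionCost ω j)) ≤
        max (ENNReal.ofReal (1 + 8 * Real.exp (-γ)))
          (ENNReal.ofReal (5 * Real.exp (-γ) + Real.exp (-1)) / ENNReal.ofReal (1 - 1 / γ))
        * ENNReal.ofReal (∑ i, R.xs i j * I.c i j) := by
  refine ⟨FacilityLocation.exists_csRun I hγ, fun K _ R => ⟨R.exists_integral_feasible,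
    R.expectation_facilityCost, fun i => ?_, fun j => ?_⟩⟩
  · rw [← R.expectation_facilityCost i]
    exact R.expectation_mono fun ω => R.openVar_mul_le_facilityCost ω i
  have hpos : 0 < 5 * Real.exp (-γ) + Real.exp (-1) := by positivity
  have hC : 0 ≤ ∑ i, R.xs i j * I.c i j :=
    Finset.sum_nonneg fun i _ => mul_nonneg (R.optimal.1.x_nonneg i j) (I.c_nonneg i j)
  rcases hγ.eq_or_lt with hγ1 | hγ1
  · rcases hC.eq_or_lt with hC0 | hC0
    · simp [R.connectionCost_eq_zero hI hγ1.symm hC0.symm, R.expectation_eq_sum]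
    · -- here the fraction is `⊤`
      have htop : ENNReal.ofReal (5 * Real.exp (-γ) + Real.exp (-1)) /
          ENNReal.ofReal (1 - 1 / γ) = ⊤ := by
        rw [← hγ1, ENNReal.div_eq_top]
        exact Or.inl ⟨by simpa using (hγ1 ▸ hpos), by simp⟩
      rw [htop, max_eq_right le_top, ENNReal.top_mul (by simpa using hC0)]
      exact le_top
  · have hγ2 : 0 < 1 - 1 / γ := by
      rw [sub_pos, div_lt_one (by linarith)]; exact hγ1
    rw [← ENNReal.ofReal_div_of_pos hγ2, ← ENNReal.ofReal_max,
      ← ENNReal.ofReal_mul (le_max_of_le_left (by positivity))]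
    exact ENNReal.ofReal_le_ofReal (R.expectation_connectionCost_le_max hI hγ1 j)
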